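/- **Setting.** Let $\mathcal M\subset\mathbb R^n$ be compact, $\mathcal U\subset\mathbb R^m$, $f:\mathcal M\times\mathcal U\to\mathcal M$, and let $x_{t+1}=f(x_t,u_t)$, $x_0\in\mathcal M$, $u_t\in\mathcal U$ ($t\ge 0$) be the (deterministic) data. Let $\varphi=(\varphi^1,\dots,\varphi^N):\mathbb R^n\to\mathbb R^N$ be the lifting functions. For $\mathcal G=[\mathcal A,\mathcal B]$ with $\mathcal A\in\mathbb R^{N\times N}$, $\mathcal B\in\mathbb R^{N\times m}$, put $r_{\mathcal G}(y,x,u)=\|\varphi(y)-\mathcal A\varphi(x)-\mathcal Bu\|^2$, and for sequences $z=(z_t)$ in $\mathbb R^n$ and $v=(v_t)$ in $\mathbb R^m$ put $$J_T(\mathcal G;z,v)=\frac1T\sum_{t=0}^{T-1}r_{\mathcal G}(z_{t+1},z_t,v_t)=\frac1T\|\Phi^+-\mathcal A\Phi-\mathcal BU\|^2$$ (Frobenius norm), where $\Phi=[\varphi(z_0)\cdots\varphi(z_{T-1})]$, $\Phi^+=[\varphi(z_1)\cdots\varphi(z_T)]$, $U=[v_0\cdots v_{T-1}]$. **Dither quantization.**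 A quantizer of word length $b$ with range $(x_{\min},x_{\max})$ has resolution $\epsilon=(x_{\max}-x_{\min})/2^b$; it encodes $y\in(x_{\min},x_{\max})$ as $q(y)=\lfloor (y-x_{\min})/\epsilon\rfloor$, saturating at $0$ and $2^b-1$ outside the range, and decodes to $\mathcal Q(y)=\epsilon q(y)+x_{\min}+\epsilon/2$. Each component $s$ of $x_t$ and of $u_t$ is replaced by $\tilde s=\mathcal Q(s+w)-w$, where the dithers $w$ for all times and all state and input components are independent and uniform on $[-\epsilon/2,\epsilon/2]$. There is no overload: all components of $x_t$ and $u_t$ lie in $[x_{\min}+\epsilon/2,\,x_{\max}-\epsilon/2]$. The quantized EDMD predictor $[\tilde A,\tilde B]=[\tilde A_T,\tilde B_T]$ is a minimizer of $\mathcal G\mapsto J_T(\mathcal G;\tilde x,\tilde u)$. **Assumptions.** (1) Each $\varphi^i$ is bounded on $\mathbb R^n$ and $(u_t)$ is bounded. (Consequently, for each fixed $\mathcal G$, the residuals $r_{\mathcal G}(x_{t+1},x_t,u_t)$ are bounded in $t$.) (2) There is $\rho\in(0,\infty]$ such that for every $\mathcal G$ and every $t$ the function $r_{\mathcal G}$ has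 at $(x_{t+1},x_t,u_t)$ an absolutely convergent Taylor series with sum $r_{\mathcal G}$ and with radius of convergence at least $\rho$ (with respect to the maximum norm). (3) Each $\varphi^i$ is differentiable and $\nabla\varphi^i$ is bounded on $\mathbb R^n$. (4) The large-data limits exist: for all $k\ge0$ and all $\mathcal G$ the limit $$\ell_k(\mathcal G)=\lim_{T\to\infty}\frac1T\sum_{t=0}^{T-1}\int_{[-\frac12,\frac12]^{n+n+m}}\frac1{k!}D^kr_{\mathcal G}(x_{t+1},x_t,u_t)[v,\dots,v]\,dv$$ exists in $\mathbb R$ (for $k=0$ this is $\lim_TJ_T(\mathcal G;x,u)$). **Theorem.** There are $\alpha_{2k}\in\mathbb R$, $\beta_{2k}\in\mathbb R^{(N+m)\times N}$, $\Gamma_{2k}\in\mathbb R^{(N+m)\times(N+m)}$, $k\ge1$, with $$\ell_{2k}(\mathcal G)=\alpha_{2k}+\operatorname{tr}(\mathcal G\beta_{2k})+\operatorname{tr}(\mathcal G^\top\mathcal G\,\Gamma_{2k})\quad\text{for all }\mathcal G,$$ such that the series $\alpha(\epsilon)=\sum_{k\ge1}\epsilon^{2k}\alpha_{2k}$, $\beta(\epsilon)=\sum_{k\ge1}\epsilon^{2k}\beta_{2k}$,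 $\Gamma(\epsilon)=\sum_{k\ge1}\epsilon^{2k}\Gamma_{2k}$ converge whenever $0<\epsilon/2<\rho$, such that $\beta(\epsilon)$ and $\Gamma(\epsilon)$ are $O(\epsilon^2)$ as $\epsilon\downarrow0$, and such that for every dither quantization as above with $\epsilon/2<\rho$ the following holds. Consider the regularized least-squares problem $$\min_{\mathcal G=[\mathcal A,\mathcal B]}R_\epsilon(\mathcal G),\qquad R_\epsilon(\mathcal G)=\limsup_{T\to\infty}\frac1T\|\Phi^+-\mathcal A\Phi-\mathcal BU\|^2+\operatorname{tr}(\mathcal G\beta(\epsilon))+\operatorname{tr}(\mathcal G^\top\mathcal G\,\Gamma(\epsilon)),$$ formed with the unquantized data $x,u$. (i) Almost surely, $J_T(\mathcal G;\tilde x,\tilde u)\to R_\epsilon(\mathcal G)+\alpha(\epsilon)$ as $T\to\infty$ for all $\mathcal G$. (ii) Almost surely, every accumulation point, as $T\to\infty$, of any sequence of quantized predictors $[\tilde A_T,\tilde B_T]$ is a solution of the regularized problem. (iii) If the regularized problem has exactly one solution, then almost surely the quantized predictor $[\tilde A_T,\tilde B_T]$ is unique for all large $T$ and converges to that solution as $T\to\infty$.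 -/

import Mathlib

open Filter Topology MeasureTheory ProbabilityTheory Asymptotics
open scoped ENNReal

noncomputable section

namespace QuantEDMD

/-! ### Least-squares objectives of EDMD -/

/-- The data matrix with columns `φ (z 0), …, φ (z (T-1))`. -/
def liftedData {n N : ℕ} (φ : (Fin n → ℝ) → Fin N → ℝ) (z : ℕ → Fin n → ℝ) (T : ℕ) :
    Matrix (Fin N) (Fin T) ℝ :=
  Matrix.of fun i t => φ (z t) i

/-- The shifted data matrix with columns `φ (z 1), …, φ (z T)`. -/
def liftedDataNext {n N : ℕ} (φ : (Fin n → ℝ) → Fin N → ℝ) (z : ℕ → Fin n → ℝ) (T : ℕ) :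
    Matrix (Fin N) (Fin T) ℝ :=
  Matrix.of fun i t => φ (z (t + 1)) i

/-- The input matrix with columns `v 0, …, v (T-1)`. -/
def inputData {m : ℕ} (v : ℕ → Fin m → ℝ) (T : ℕ) : Matrix (Fin m) (Fin T) ℝ :=
  Matrix.of fun j t => v t j

/-- The square of the Frobenius norm. -/
def frobSq {N T : ℕ} (X : Matrix (Fin N) (Fin T) ℝ) : ℝ :=
  ∑ i, ∑ t, X i t ^ 2

/-- The EDMD least-squares objective `(1/T) ‖Φ⁺ - A Φ - B U‖²` at `G = (A, B)`, for the states `z`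
and the inputs `v`. It is used for the exact data as well as for the quantized data. -/
def edmdCost {n m N : ℕ} (φ : (Fin n → ℝ) → Fin N → ℝ) (z : ℕ → Fin n → ℝ) (v : ℕ → Fin m → ℝ)
    (T : ℕ) (G : Matrix (Fin N) (Fin N) ℝ × Matrix (Fin N) (Fin m) ℝ) : ℝ :=
  1 / (T : ℝ) * frobSq (liftedDataNext φ z T - G.1 * liftedData φ z T - G.2 * inputData v T)

/-- The set of minimizers of a function. -/
def argmin {X : Type*} (F : X → ℝ) : Set X :=
  {G | ∀ G', F G ≤ F G'}

/-- The regularization term `tr(𝒢 β) + tr(𝒢ᵀ 𝒢 Γ)` with `𝒢 = [A, B]`. -/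
def regTerm {m N : ℕ} (β : Matrix (Fin N ⊕ Fin m) (Fin N) ℝ)
    (Γ : Matrix (Fin N ⊕ Fin m) (Fin N ⊕ Fin m) ℝ)
    (G : Matrix (Fin N) (Fin N) ℝ × Matrix (Fin N) (Fin m) ℝ) : ℝ :=
  (Matrix.fromCols G.1 G.2 * β).trace +
    ((Matrix.fromCols G.1 G.2).transpose * Matrix.fromCols G.1 G.2 * Γ).trace

/-- The objective of the regularized large-data problem,
`limsup_T (1/T) ‖Φ⁺ - A Φ - B U‖² + tr(𝒢 β) + tr(𝒢ᵀ 𝒢 Γ)`. -/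
def regCost {n m N : ℕ} (φ : (Fin n → ℝ) → Fin N → ℝ) (x : ℕ → Fin n → ℝ) (u : ℕ → Fin m → ℝ)
    (β : Matrix (Fin N ⊕ Fin m) (Fin N) ℝ) (Γ : Matrix (Fin N ⊕ Fin m) (Fin N ⊕ Fin m) ℝ)
    (G : Matrix (Fin N) (Fin N) ℝ × Matrix (Fin N) (Fin m) ℝ) : ℝ :=
  limsup (fun T : ℕ => edmdCost φ x u T G) atTop + regTerm β Γ G

/-! ### The one-step residual and its Taylor terms -/

/-- The one-step residual `r(y, x, u) = ‖φ(y) - A φ(x) - B u‖²` (Euclidean norm). -/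
def residual {n m N : ℕ} (φ : (Fin n → ℝ) → Fin N → ℝ)
    (G : Matrix (Fin N) (Fin N) ℝ × Matrix (Fin N) (Fin m) ℝ)
    (p : (Fin n → ℝ) × (Fin n → ℝ) × (Fin m → ℝ)) : ℝ :=
  ∑ i, (φ p.1 i - G.1.mulVec (φ p.2.1) i - G.2.mulVec p.2.2 i) ^ 2

/-- The data point `(x_{t+1}, x_t, u_t)`. -/
def dataPoint {n m : ℕ} (x : ℕ → Fin n → ℝ) (u : ℕ → Fin m → ℝ) (t : ℕ) :
    (Fin n → ℝ) × (Fin n → ℝ) × (Fin m → ℝ) :=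
  (x (t + 1), x t, u t)

/-- The mean of the `k`-th Taylor term `(1/k!) Dᵏg(p)[v, …, v]` over a vector `v` whose components
are independent and uniform on `[-1/2, 1/2]`. The norm is the maximum of the moduli of the
components, so the closed ball is the cube `[-1/2, 1/2]^(n+n+m)`, which has volume one. -/
def taylorMean {n m : ℕ} (k : ℕ) (g : (Fin n → ℝ) × (Fin n → ℝ) × (Fin m → ℝ) → ℝ)
    (p : (Fin n → ℝ) × (Fin n → ℝ) × (Fin m → ℝ)) : ℝ :=
  ∫ v in Metric.closedBall (0 : (Fin n → ℝ) × (Fin n → ℝ) × (Fin m → ℝ)) (1 / 2),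
    1 / (k.factorial : ℝ) * iteratedFDeriv ℝ k g p (fun _ => v)

/-- The time average `(1/T) ∑_{t<T}` of the mean `k`-th Taylor term of the residual along the
data. -/
def taylorAverage {n m N : ℕ} (φ : (Fin n → ℝ) → Fin N → ℝ) (x : ℕ → Fin n → ℝ)
    (u : ℕ → Fin m → ℝ) (k : ℕ) (G : Matrix (Fin N) (Fin N) ℝ × Matrix (Fin N) (Fin m) ℝ)
    (T : ℕ) : ℝ :=
  1 / (T : ℝ) * ∑ t ∈ Finset.range T, taylorMean k (residual φ G) (dataPoint x u t)

/-! ### Dither quantization -/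

/-- The resolution of a uniform quantizer of word length `b` on `(lo, hi)`. -/
def resolution (lo hi : ℝ) (b : ℕ) : ℝ :=
  (hi - lo) / 2 ^ b

/-- The uniform quantizer of word length `b` on `(lo, hi)`, saturated outside that interval. -/
def encode (lo hi : ℝ) (b : ℕ) (y : ℝ) : ℤ :=
  if y ≤ lo then 0 else if hi ≤ y then 2 ^ b - 1 else ⌊(y - lo) / resolution lo hi b⌋

/-- The mid-point reconstruction of the quantized value of `y`. -/
def decode (lo hi : ℝ) (b : ℕ) (y : ℝ) : ℝ :=
  resolution lo hi b * (encode lo hi b y : ℝ) + lo + resolution lo hi b / 2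

/-- Dither quantization of the value `y` with dither `w`: quantize `y + w`, then subtract `w`. -/
def ditherQuantize (lo hi : ℝ) (b : ℕ) (y w : ℝ) : ℝ :=
  decode lo hi b (y + w) - w

/-- `w t (inl i)` and `w t (inr j)` are the dithers at time `t` for the `i`-th state component and
for the `j`-th input component. All of them are independent, and each is uniform on
`[-ε/2, ε/2]`. -/
structure IsDither {Ω : Type*} [MeasurableSpace Ω] {n m : ℕ} (P : Measure Ω) (ε : ℝ)
    (w : ℕ → Fin n ⊕ Fin m → Ω → ℝ) : Prop where
  measurable : ∀ t c, Measurable (w t c)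
  indep : iIndepFun (fun c : ℕ × (Fin n ⊕ Fin m) => w c.1 c.2) P
  uniform : ∀ t c, pdf.IsUniform (w t c) (Set.Icc (-(ε / 2)) (ε / 2)) P

/-- The dither quantized states. -/
def quantState {Ω : Type*} {n m : ℕ} (lo hi : ℝ) (b : ℕ) (w : ℕ → Fin n ⊕ Fin m → Ω → ℝ)
    (x : ℕ → Fin n → ℝ) (ω : Ω) (t : ℕ) : Fin n → ℝ :=
  fun i => ditherQuantize lo hi b (x t i) (w t (Sum.inl i) ω)

/-- The dither quantized inputs. -/
def quantInput {Ω : Type*} {n m : ℕ} (lo hi : ℝ) (b : ℕ) (w : ℕ → Fin n ⊕ Fin m → Ω → ℝ)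
    (u : ℕ → Fin m → ℝ) (ω : Ω) (t : ℕ) : Fin m → ℝ :=
  fun j => ditherQuantize lo hi b (u t j) (w t (Sum.inr j) ω)

/-- No quantizer overload: every state and input component stays at least `ε/2` inside the range
of the quantizer, so that the dithered values do not leave the range. -/
def NoOverload {n m : ℕ} (lo hi : ℝ) (b : ℕ) (x : ℕ → Fin n → ℝ) (u : ℕ → Fin m → ℝ) : Prop :=
  (∀ t i, x t i ∈ Set.Icc (lo + resolution lo hi b / 2) (hi - resolution lo hi b / 2)) ∧
    ∀ t j, u t j ∈ Set.Icc (lo + resolution lo hi b / 2) (hi - resolution lo hi b / 2)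

end QuantEDMD

end

/-! Without overload, the quantization error of each component is `ε` times `1/2 - fract ((s + w -
lo) / ε)`, which is uniform on `ε • [-1/2, 1/2]` whatever the signal `s` is (`map_ditherError`). So
the quantized data point is `p_t + ε V_t` with `V_t` uniform on the unit cube. `V_t` and `V_{t+1}`
share the dithers of `x_{t+1}`, but errors two steps apart are independent; a second-moment strong
law (`strong_law_of_bounded`) replaces the quantized cost by the time average of the means of `r_G
(p_t + ε V)`.

Expanding each mean in a Taylor series, the odd terms cancel by symmetry of the cube. Cauchy
estimates uniform over the totally bounded data (`exists_forall_abs_taylor_le`) dominate the series,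
so the limit in `T` passes through the sum and gives `ℓ_0 + ∑ ε^(2k) ℓ_{2k}`.

The dependence on `G` is finite-dimensional: `r_G` is the functional `regEval G` applied to a vector
depending on the data point only, hence `r_G = ∑ λ_i(G) r_{H_i}` for finitely many `H_i`
(`exists_residual_interpolation`). This yields the coefficients `α, β, Γ`, and one null set serves
all `G`. Continuity of the `λ_i` handles accumulation points. Convexity of the finite-data costs
along lines handles uniqueness: being larger on a small sphere around the minimizer propagates
outwards (`eventually_forall_lt_of_argmin_eq`). -/

noncomputable section

namespace QuantEDMD

/-! ### A strong law for bounded, `1`-dependent variables -/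

/-- If `|X t| ≤ C` and `S` vanishes on average along the squares, it vanishes on average. -/
theorem tendsto_average_of_tendsto_average_sq {a : ℕ → ℝ} {C : ℝ} (ha : ∀ t, |a t| ≤ C)
    (h : Tendsto (fun k : ℕ => (∑ t ∈ Finset.range (k ^ 2), a t) / (k : ℝ) ^ 2) atTop (𝓝 0)) :
    Tendsto (fun T : ℕ => 1 / (T : ℝ) * ∑ t ∈ Finset.range T, a t) atTop (𝓝 0) := by
  have hC : 0 ≤ C := (abs_nonneg _).trans (ha 0)
  have hsqrt : Tendsto Nat.sqrt atTop atTop := by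
    refine tendsto_atTop.2 fun b => ?_
    filter_upwards [eventually_ge_atTop (b * b)] with T hT
    exact Nat.le_sqrt.2 hT
  have h1 : Tendsto (fun k : ℕ => |(∑ t ∈ Finset.range (k ^ 2), a t) / (k : ℝ) ^ 2| +
      2 * C * (1 / (k : ℝ))) atTop (𝓝 0) := by
    simpa using h.abs.add (tendsto_one_div_atTop_nhds_zero_nat.const_mul (2 * C))
  refine squeeze_zero_norm' ?_ (h1.comp hsqrt)
  filter_upwards [eventually_ge_atTop 1] with T hT
  have hk1 : 1 ≤ Nat.sqrt T := Nat.le_sqrt.2 (by simpa using hT)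
  simp only [Function.comp]
  -- Since `k ^ 2 ≤ T ≤ k ^ 2 + 2 * k`, the terms beyond the last square contribute at most `2 * k *
  -- C`, which is `O(1/k)` after division by `k ^ 2`.
  set k := Nat.sqrt T with hk
  have hkT : k ^ 2 ≤ T := by rw [sq]; exact Nat.sqrt_le T
  have hTk : T ≤ k ^ 2 + 2 * k := by
    have := Nat.sqrt_le_add T
    rw [← hk] at this
    nlinarith
  have hkpos : (0 : ℝ) < k := by exact_mod_cast hk1
  have hTpos : (0 : ℝ) < T := by exact_mod_cast hT
  have hkTR : (k : ℝ) ^ 2 ≤ T := by exact_mod_cast hkT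
  have hsplit : ∑ t ∈ Finset.range T, a t =
      ∑ t ∈ Finset.range (k ^ 2), a t + ∑ t ∈ Finset.Ico (k ^ 2) T, a t :=
    (Finset.sum_range_add_sum_Ico _ hkT).symm
  have hrest : |∑ t ∈ Finset.Ico (k ^ 2) T, a t| ≤ 2 * k * C := by
    refine (Finset.abs_sum_le_sum_abs _ _).trans ((Finset.sum_le_sum fun t _ => ha t).trans ?_)
    rw [Finset.sum_const, Nat.card_Ico, nsmul_eq_mul]
    refine mul_le_mul_of_nonneg_right ?_ hC
    have : T - k ^ 2 ≤ 2 * k := by omega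
    exact_mod_cast this
  rw [hsplit, Real.norm_eq_abs, abs_mul, abs_of_pos (one_div_pos.2 hTpos), abs_div,
    abs_of_pos (pow_pos hkpos 2)]
  calc 1 / (T : ℝ) * |∑ t ∈ Finset.range (k ^ 2), a t + ∑ t ∈ Finset.Ico (k ^ 2) T, a t|
      ≤ 1 / (k : ℝ) ^ 2 * (|∑ t ∈ Finset.range (k ^ 2), a t| + 2 * k * C) := by
        refine mul_le_mul (one_div_le_one_div_of_le (by positivity) hkTR)
          ((abs_add_le _ _).trans (by gcongr)) (abs_nonneg _) (by positivity)
    _ = |∑ t ∈ Finset.range (k ^ 2), a t| / (k : ℝ) ^ 2 + 2 * C * (1 / (k : ℝ)) := by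
        field_simp

section StrongLaw

variable {Ω : Type*} [MeasurableSpace Ω]

/-- In the expanded square only the pairs with `|s - t| ≤ 1` can have nonzero mean, and each `s` has
at most three such partners. The second moment therefore grows linearly in `T`. -/
theorem integral_sum_sq_le {P : Measure Ω} [IsProbabilityMeasure P] {X : ℕ → Ω → ℝ} {C : ℝ}
    (hmeas : ∀ t, Measurable (X t)) (hbdd : ∀ t ω, |X t ω| ≤ C) (hmean : ∀ t, ∫ ω, X t ω ∂P = 0)
    (hindep : ∀ s t, s + 2 ≤ t → IndepFun (X s) (X t) P) (T : ℕ) :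
    ∫ ω, (∑ t ∈ Finset.range T, X t ω) ^ 2 ∂P ≤ 3 * C ^ 2 * T := by
  have hint : ∀ s t, Integrable (fun ω => X s ω * X t ω) P := fun s t =>
    Integrable.of_bound ((hmeas s).mul (hmeas t)).aestronglyMeasurable (C * C)
      (ae_of_all _ fun ω => by
        rw [Real.norm_eq_abs, abs_mul]
        exact mul_le_mul (hbdd s ω) (hbdd t ω) (abs_nonneg _) ((abs_nonneg _).trans (hbdd s ω)))
  have hzero : ∀ s t, s + 2 ≤ t → ∫ ω, X s ω * X t ω ∂P = 0 := fun s t hst => by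
    have := (hindep s t hst).integral_fun_mul_eq_mul_integral
      (hmeas s).aestronglyMeasurable (hmeas t).aestronglyMeasurable
    rw [this, hmean, zero_mul]
  have hle : ∀ s t, ∫ ω, X s ω * X t ω ∂P ≤ if s ≤ t + 1 ∧ t ≤ s + 1 then C ^ 2 else 0 := by
    intro s t
    split_ifs with h
    · calc ∫ ω, X s ω * X t ω ∂P ≤ ∫ _, C ^ 2 ∂P := by
            refine integral_mono (hint s t) (integrable_const _) fun ω => ?_
            refine (le_abs_self _).trans ?_
            simp only [abs_mul, sq]
            exact mul_le_mul (hbdd s ω) (hbdd t ω) (abs_nonneg _)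
              ((abs_nonneg _).trans (hbdd s ω))
        _ = C ^ 2 := by simp
    · rcases le_or_gt (s + 2) t with h' | h'
      · exact (hzero s t h').le
      · have : ∫ ω, X s ω * X t ω ∂P = ∫ ω, X t ω * X s ω ∂P := by simp_rw [mul_comm]
        rw [this]
        exact (hzero t s (by omega)).le
  simp_rw [sq (Finset.sum _ _), Finset.sum_mul_sum]
  rw [integral_finsetSum _ fun s _ => integrable_finsetSum _ fun t _ => hint s t]
  calc ∑ s ∈ Finset.range T, ∫ ω, ∑ t ∈ Finset.range T, X s ω * X t ω ∂P
      ≤ ∑ s ∈ Finset.range T, 3 * C ^ 2 := by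
        refine Finset.sum_le_sum fun s _ => ?_
        rw [integral_finsetSum _ fun t _ => hint s t]
        refine (Finset.sum_le_sum fun t _ => hle s t).trans ?_
        rw [← Finset.sum_filter, Finset.sum_const, nsmul_eq_mul]
        refine mul_le_mul_of_nonneg_right ?_ (sq_nonneg C)
        have : (Finset.range T).filter (fun t => s ≤ t + 1 ∧ t ≤ s + 1) ⊆
            Finset.Icc (s - 1) (s + 1) := by
          intro t ht
          simp only [Finset.mem_filter, Finset.mem_Icc] at ht ⊢
          omega
        have := Finset.card_le_card this
        rw [Nat.card_Icc] at this
        have h3 : (Finset.filter (fun t => s ≤ t + 1 ∧ t ≤ s + 1) (Finset.range T)).card ≤ 3 := by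
          omega
        exact_mod_cast h3
    _ = 3 * C ^ 2 * T := by simp; ring

/-- A strong law of large numbers for bounded centred variables such that `X s` and `X t` are
independent whenever `s` and `t` are at least two apart. -/
theorem strong_law_of_bounded {P : Measure Ω} [IsProbabilityMeasure P] {X : ℕ → Ω → ℝ} {C : ℝ}
    (hmeas : ∀ t, Measurable (X t)) (hbdd : ∀ t ω, |X t ω| ≤ C) (hmean : ∀ t, ∫ ω, X t ω ∂P = 0)
    (hindep : ∀ s t, s + 2 ≤ t → IndepFun (X s) (X t) P) :
    ∀ᵐ ω ∂P, Tendsto (fun T : ℕ => 1 / (T : ℝ) * ∑ t ∈ Finset.range T, X t ω) atTop (𝓝 0) := by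
  -- Along the squares the mean of `Y k` is at most `3 C² / k²`, which is summable. Hence `∑ Y k` is
  -- almost surely finite and its terms tend to zero.
  set Y : ℕ → Ω → ℝ := fun k ω => ((∑ t ∈ Finset.range (k ^ 2), X t ω) / (k : ℝ) ^ 2) ^ 2
    with hY
  have hYmeas : ∀ k, Measurable (Y k) := fun k =>
    ((Finset.measurable_fun_sum _ fun t _ => hmeas t).div_const _).pow_const 2
  have hYle : ∀ k : ℕ, ∫⁻ ω, ENNReal.ofReal (Y k ω) ∂P ≤
      ENNReal.ofReal (3 * C ^ 2 * (1 / (k : ℝ) ^ 2)) := by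
    intro k
    have hb : ∀ ω, |∑ t ∈ Finset.range (k ^ 2), X t ω| ≤ (k ^ 2 : ℕ) * C := fun ω => by
      refine (Finset.abs_sum_le_sum_abs _ _).trans
        ((Finset.sum_le_sum fun t _ => hbdd t ω).trans ?_)
      simp
    have hi : Integrable (fun ω => (∑ t ∈ Finset.range (k ^ 2), X t ω) ^ 2) P :=
      Integrable.of_bound ((Finset.measurable_fun_sum _ fun t _ =>
        hmeas t).pow_const 2).aestronglyMeasurable (((k ^ 2 : ℕ) * C) ^ 2) (ae_of_all _ fun ω => by
          rw [norm_pow]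
          exact pow_le_pow_left₀ (norm_nonneg _) (hb ω) 2)
    have hYi : Integrable (Y k) P := by
      simp only [hY, div_pow]
      exact hi.div_const _
    rw [← ofReal_integral_eq_lintegral_ofReal hYi (ae_of_all _ fun ω => sq_nonneg _)]
    refine ENNReal.ofReal_le_ofReal ?_
    simp only [hY, div_pow]
    rw [integral_div]
    rcases Nat.eq_zero_or_pos k with rfl | hk
    · simp
    have hkpos : (0 : ℝ) < k := by exact_mod_cast hk
    rw [div_le_iff₀ (by positivity)]
    refine (integral_sum_sq_le hmeas hbdd hmean hindep (k ^ 2)).trans_eq ?_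
    push_cast
    field_simp
  have hsum : ∫⁻ ω, ∑' k, ENNReal.ofReal (Y k ω) ∂P ≠ ∞ := by
    rw [lintegral_tsum fun k => (hYmeas k).ennreal_ofReal.aemeasurable]
    refine ne_top_of_le_ne_top ?_ (ENNReal.tsum_le_tsum hYle)
    have hs : Summable fun k : ℕ => 3 * C ^ 2 * (1 / (k : ℝ) ^ 2) :=
      (Real.summable_one_div_nat_pow.2 one_lt_two).mul_left _
    rw [← ENNReal.ofReal_tsum_of_nonneg (fun k => by positivity) hs]
    exact ENNReal.ofReal_ne_top
  filter_upwards [ae_lt_top' (AEMeasurable.tsum fun k =>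
    (hYmeas k).ennreal_ofReal.aemeasurable) hsum] with ω hω
  refine tendsto_average_of_tendsto_average_sq (fun t => hbdd t ω) ?_
  have h1 := ENNReal.tendsto_atTop_zero_of_tsum_ne_top hω.ne
  have h2 : Tendsto (fun k => Y k ω) atTop (𝓝 0) := by
    have := (ENNReal.tendsto_toReal ENNReal.zero_ne_top).comp h1
    refine (this.congr fun k => ?_)
    exact ENNReal.toReal_ofReal (sq_nonneg _)
  have h3 := (Real.continuous_sqrt.tendsto 0).comp h2
  simp only [Function.comp_def, hY, Real.sqrt_sq_eq_abs, Real.sqrt_zero] at h3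
  exact (tendsto_zero_iff_abs_tendsto_zero _).2 h3

end StrongLaw

/-! ### Uniform Taylor estimates -/

section Taylor

open scoped NNReal

variable {E : Type*} [NormedAddCommGroup E] [NormedSpace ℝ E]

/-- The right-hand side is the full double series of the re-expansion, finite because `δ + r` is
below the radius; one value of `k` is a part of it. The point is that the bound depends on neither
`x` nor `k`. -/
theorem nnnorm_changeOrigin_mul_pow_le (S : FormalMultilinearSeries ℝ E ℝ) {x : E} {r δ : ℝ≥0}
    (hx : ‖x‖₊ ≤ δ) (h : (δ + r : ℝ≥0∞) < S.radius) (k : ℕ) :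
    ‖S.changeOrigin x k‖₊ * r ^ k ≤
      ∑' k : ℕ, ∑' s : Σ l : ℕ, { s : Finset (Fin (k + l)) // s.card = l },
        ‖S (k + s.1)‖₊ * δ ^ s.1 * r ^ k := by
  have hs := S.changeOriginSeries_summable_aux₁ h
  have hδ : (δ : ℝ≥0∞) < S.radius := le_self_add.trans_lt h
  have hx' : (‖x‖₊ : ℝ≥0∞) < S.radius := (ENNReal.coe_le_coe.2 hx).trans_lt hδ
  calc ‖S.changeOrigin x k‖₊ * r ^ k
      ≤ (∑' s : Σ l : ℕ, { s : Finset (Fin (k + l)) // s.card = l },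
          ‖S (k + s.1)‖₊ * ‖x‖₊ ^ s.1) * r ^ k := by
        gcongr
        exact S.nnnorm_changeOrigin_le k hx'
    _ ≤ (∑' s : Σ l : ℕ, { s : Finset (Fin (k + l)) // s.card = l },
          ‖S (k + s.1)‖₊ * δ ^ s.1) * r ^ k := by
        gcongr
        · exact S.changeOriginSeries_summable_aux₂ hx' k
        · exact S.changeOriginSeries_summable_aux₂ hδ k
    _ = ∑' s : Σ l : ℕ, { s : Finset (Fin (k + l)) // s.card = l },
          ‖S (k + s.1)‖₊ * δ ^ s.1 * r ^ k := (NNReal.tsum_mul_right _ _).symm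
    _ ≤ _ := (NNReal.summable_sigma.1 hs).2.le_tsum k fun _ _ => zero_le

/-- If `g` has a power series of radius at least `ρ` at all points of a totally bounded set, its
Taylor coefficients satisfy Cauchy estimates of every radius `r < ρ`, uniformly on the set. -/
theorem exists_forall_abs_taylor_le {g : E → ℝ} {K : Set E} (hK : TotallyBounded K) {ρ : ℝ≥0∞}
    (hg : ∀ p ∈ K, ∃ S : FormalMultilinearSeries ℝ _ ℝ, HasFPowerSeriesOnBall g S p ρ) {r : ℝ≥0} (hr : (r : ℝ≥0∞) < ρ) :
    ∃ C : ℝ, 0 ≤ C ∧ ∀ p ∈ K, ∀ (k : ℕ) (v : E),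
      |1 / (k.factorial : ℝ) * iteratedFDeriv ℝ k g p (fun _ => v)| * r ^ k ≤ C * ‖v‖ ^ k := by
  -- The gap `ρ - r` leaves room for a `δ` with `r + δ < ρ`. Re-expanding from the centres of a
  -- finite `δ`-net in `K` reaches every point of `K`, so finitely many constants `B p` suffice.
  obtain ⟨δ, hδ, hrδ⟩ := ENNReal.lt_iff_exists_add_pos_lt.1 hr
  obtain ⟨s, hsK, hsfin, hcover⟩ :=
    Metric.finite_approx_of_totallyBounded hK δ (by exact_mod_cast hδ)
  choose! S hS using hg
  set B : E → ℝ≥0 := fun p => ∑' k : ℕ, ∑' s : Σ l : ℕ, { s : Finset (Fin (k + l)) // s.card = l },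
    ‖S p (k + s.1)‖₊ * δ ^ s.1 * r ^ k
  refine ⟨((∑ p ∈ hsfin.toFinset, B p : ℝ≥0) : ℝ), NNReal.coe_nonneg _, fun q hq k v => ?_⟩
  obtain ⟨p, hps, hqp⟩ := Set.mem_iUnion₂.1 (hcover hq)
  have hp := hS p (hsK hps)
  have hnorm : ‖q - p‖₊ < δ := by
    rw [Metric.mem_ball, dist_eq_norm] at hqp
    exact_mod_cast hqp
  have hrδ' : (δ + r : ℝ≥0∞) < ρ := by rwa [add_comm]
  have hlt : (‖q - p‖₊ : ℝ≥0∞) < ρ :=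
    (ENNReal.coe_lt_coe.2 hnorm).trans (le_self_add.trans_lt hrδ')
  have hseries := hp.changeOrigin hlt
  rw [add_sub_cancel] at hseries
  have hterm : 1 / (k.factorial : ℝ) * iteratedFDeriv ℝ k g q (fun _ => v) =
      (S p).changeOrigin (q - p) k fun _ => v := by
    rw [← hseries.factorial_smul v k, nsmul_eq_mul]
    have := Nat.factorial_ne_zero k
    field_simp
  have hB : ‖(S p).changeOrigin (q - p) k‖ * r ^ k ≤ B p := by
    exact_mod_cast nnnorm_changeOrigin_mul_pow_le (S p) hnorm.le (hrδ'.trans_le hp.r_le) k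
  have hBle : (B p : ℝ) ≤ (∑ p ∈ hsfin.toFinset, B p : ℝ≥0) := by
    exact_mod_cast Finset.single_le_sum (f := B) (fun _ _ => zero_le)
      (hsfin.mem_toFinset.2 hps)
  rw [hterm, ← Real.norm_eq_abs]
  calc ‖(S p).changeOrigin (q - p) k fun _ => v‖ * r ^ k
      ≤ (‖(S p).changeOrigin (q - p) k‖ * ‖v‖ ^ k) * r ^ k := by
        gcongr
        simpa using ((S p).changeOrigin (q - p) k).le_opNorm fun _ => v
    _ = (‖(S p).changeOrigin (q - p) k‖ * r ^ k) * ‖v‖ ^ k := by ring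
    _ ≤ _ := by gcongr; exact hB.trans hBle

end Taylor

/-! ### Means of Taylor terms over the unit cube. -/

section Cube

variable {n m : ℕ}

instance instIsNegInvariantTriple :
    (volume : Measure ((Fin n → ℝ) × (Fin n → ℝ) × (Fin m → ℝ))).IsNegInvariant :=
  ⟨((Measure.measurePreserving_neg volume).prod
    ((Measure.measurePreserving_neg volume).prod (Measure.measurePreserving_neg volume))).map_eq⟩

theorem volume_closedBall_half :
    volume (Metric.closedBall (0 : (Fin n → ℝ) × (Fin n → ℝ) × (Fin m → ℝ)) (1 / 2)) = 1 := by
  have h : ∀ d : ℕ, volume (Metric.closedBall (0 : Fin d → ℝ) (1 / 2)) = 1 := fun d => by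
    rw [Real.volume_pi_closedBall _ (by norm_num)]
    simp
  have h0 : (0 : (Fin n → ℝ) × (Fin n → ℝ) × (Fin m → ℝ)) = (0, 0, 0) := rfl
  rw [h0, ← closedBall_prod_same, ← closedBall_prod_same, Measure.volume_eq_prod,
    Measure.prod_prod, Measure.volume_eq_prod, Measure.prod_prod, h, h]
  simp

instance instIsProbabilityMeasureCube : IsProbabilityMeasure ((volume : Measure
    ((Fin n → ℝ) × (Fin n → ℝ) × (Fin m → ℝ))).restrict (Metric.closedBall 0 (1 / 2))) :=
  ⟨by rw [Measure.restrict_apply_univ, volume_closedBall_half]⟩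

theorem taylorMean_zero (g : (Fin n → ℝ) × (Fin n → ℝ) × (Fin m → ℝ) → ℝ)
    (p : (Fin n → ℝ) × (Fin n → ℝ) × (Fin m → ℝ)) : taylorMean 0 g p = g p := by
  simp only [taylorMean, iteratedFDeriv_zero_apply, Nat.factorial_zero, Nat.cast_one, div_one,
    one_mul, integral_const, probReal_univ, one_smul]

/-- The cube is invariant under `v ↦ -v`, while a homogeneous form of odd degree changes sign. -/
theorem taylorMean_of_odd {k : ℕ} (hk : Odd k)
    (g : (Fin n → ℝ) × (Fin n → ℝ) × (Fin m → ℝ) → ℝ)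
    (p : (Fin n → ℝ) × (Fin n → ℝ) × (Fin m → ℝ)) : taylorMean k g p = 0 := by
  have hmeas : MeasurableSet
    (Metric.closedBall (0 : (Fin n → ℝ) × (Fin n → ℝ) × (Fin m → ℝ)) (1 / 2)) :=
    measurableSet_closedBall
  have h : taylorMean k g p = -taylorMean k g p := by
    conv_lhs => rw [taylorMean, ← integral_indicator hmeas, ← integral_neg_eq_self]
    rw [taylorMean, ← integral_indicator hmeas, ← integral_neg]
    congr 1
    funext v
    simp only [Set.indicator, mem_closedBall_zero_iff, norm_neg]
    split_ifs
    · have : (fun _ : Fin k => -v) = fun i => (fun _ : Fin k => (-1 : ℝ)) i • (fun _ => v) i := by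
        funext i; simp
      rw [this, ContinuousMultilinearMap.map_smul_univ]
      simp [hk.neg_one_pow]
    · simp
  linarith

theorem integrable_taylor (k : ℕ) (g : (Fin n → ℝ) × (Fin n → ℝ) × (Fin m → ℝ) → ℝ)
    (p : (Fin n → ℝ) × (Fin n → ℝ) × (Fin m → ℝ)) :
    IntegrableOn (fun v => 1 / (k.factorial : ℝ) * iteratedFDeriv ℝ k g p (fun _ => v))
      (Metric.closedBall 0 (1 / 2)) := by
  refine ContinuousOn.integrableOn_compact (isCompact_closedBall _ _) (Continuous.continuousOn ?_)
  have := (iteratedFDeriv ℝ k g p).cont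
  fun_prop

/-- On the cube `‖v‖ ≤ 1/2`, so averaging improves the Cauchy radius from `r` to `2 * r`. This is
why the condition on the resolution reads `ε / 2 < ρ`. -/
theorem abs_taylorMean_mul_pow_le {g : (Fin n → ℝ) × (Fin n → ℝ) × (Fin m → ℝ) → ℝ}
    {p : (Fin n → ℝ) × (Fin n → ℝ) × (Fin m → ℝ)} {C r : ℝ} (hC : 0 ≤ C) (hr : 0 ≤ r) {k : ℕ}
    (h : ∀ v, |1 / (k.factorial : ℝ) * iteratedFDeriv ℝ k g p (fun _ => v)| * r ^ k ≤
      C * ‖v‖ ^ k) : |taylorMean k g p| * (2 * r) ^ k ≤ C := by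
  have hf : ∀ v ∈ Metric.closedBall (0 : (Fin n → ℝ) × (Fin n → ℝ) × (Fin m → ℝ)) (1 / 2),
      ‖1 / (k.factorial : ℝ) * iteratedFDeriv ℝ k g p (fun _ => v) * (2 * r) ^ k‖ ≤ C := by
    intro v hv
    rw [mem_closedBall_zero_iff] at hv
    rw [mul_pow, norm_mul, Real.norm_eq_abs, Real.norm_of_nonneg (by positivity)]
    calc |1 / (k.factorial : ℝ) * iteratedFDeriv ℝ k g p (fun _ => v)| * (2 ^ k * r ^ k)
        = |1 / (k.factorial : ℝ) * iteratedFDeriv ℝ k g p (fun _ => v)| * r ^ k * 2 ^ k := by ring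
      _ ≤ C * ‖v‖ ^ k * 2 ^ k := mul_le_mul_of_nonneg_right (h v) (by positivity)
      _ = C * (‖v‖ * 2) ^ k := by rw [mul_pow]; ring
      _ ≤ C * 1 := by
          gcongr
          exact pow_le_one₀ (by positivity) (by linarith)
      _ = C := mul_one C
  have hle := norm_integral_le_of_norm_le_const
    (ae_restrict_of_forall_mem (μ := volume) measurableSet_closedBall hf)
  rwa [probReal_univ, mul_one, integral_mul_const, norm_mul, Real.norm_eq_abs,
    Real.norm_of_nonneg (pow_nonneg (by positivity) k)] at hle

/-- The mean of a power series over a cube of half-width `ε / 2` less than its radius. -/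
theorem hasSum_taylorMean {g : (Fin n → ℝ) × (Fin n → ℝ) × (Fin m → ℝ) → ℝ}
    {p : (Fin n → ℝ) × (Fin n → ℝ) × (Fin m → ℝ)} {ρ : ℝ≥0∞}
    (hg : ∃ S : FormalMultilinearSeries ℝ _ ℝ, HasFPowerSeriesOnBall g S p ρ) {C r ε : ℝ} (hε : 0 < ε)
    (hερ : ENNReal.ofReal (ε / 2) < ρ) (hεr : ε < 2 * r) (hC : 0 ≤ C)
    (h : ∀ (k : ℕ) v, |1 / (k.factorial : ℝ) * iteratedFDeriv ℝ k g p (fun _ => v)| * r ^ k ≤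
      C * ‖v‖ ^ k) :
    HasSum (fun k => ε ^ (2 * k) * taylorMean (2 * k) g p)
      (∫ v in Metric.closedBall 0 (1 / 2), g (p + ε • v)) := by
  have hr : 0 < r := by linarith
  have hall : HasSum (fun k => ε ^ k * taylorMean k g p)
      (∫ v in Metric.closedBall 0 (1 / 2), g (p + ε • v)) := by
    simp only [taylorMean, ← integral_const_mul]
    -- On the cube the `k`-th term is at most `C (ε / (2r)) ^ k`, a geometric majorant of ratio
    -- below one.
    refine hasSum_integral_of_dominated_convergence (fun k _ => C * (ε / (2 * r)) ^ k)
      (fun k => ((integrable_taylor k g p).const_mul _).aestronglyMeasurable) (fun k => ?_)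
      (ae_of_all _ fun _ => ?_) (integrable_const _) ?_
    · refine ae_restrict_of_forall_mem measurableSet_closedBall fun v hv => ?_
      rw [mem_closedBall_zero_iff] at hv
      have h1 : |1 / (k.factorial : ℝ) * iteratedFDeriv ℝ k g p (fun _ => v)| ≤
          C * ‖v‖ ^ k / r ^ k := (le_div_iff₀ (by positivity)).2 (h k v)
      rw [norm_mul, Real.norm_of_nonneg (by positivity), Real.norm_eq_abs]
      calc ε ^ k * |1 / (k.factorial : ℝ) * iteratedFDeriv ℝ k g p (fun _ => v)|
          ≤ ε ^ k * (C * (1 / 2) ^ k / r ^ k) := by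
            gcongr
            refine h1.trans ?_
            gcongr
        _ = C * (ε / (2 * r)) ^ k := by
            rw [div_pow, div_pow, mul_pow]
            field_simp
            rw [one_pow, mul_one]
    · refine (summable_geometric_of_lt_one (by positivity) ?_).mul_left C
      rwa [div_lt_one (by positivity)]
    · refine ae_restrict_of_forall_mem measurableSet_closedBall fun v hv => ?_
      rw [mem_closedBall_zero_iff] at hv
      obtain ⟨S, hS⟩ := hg
      have hmem : ε • v ∈ Metric.eball (0 : (Fin n → ℝ) × (Fin n → ℝ) × (Fin m → ℝ)) ρ := by
        rw [Metric.mem_eball, edist_zero_right, ← ofReal_norm, norm_smul,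
          Real.norm_of_nonneg hε.le]
        refine (ENNReal.ofReal_le_ofReal ?_).trans_lt hερ
        nlinarith
      convert! hS.hasSum_iteratedFDeriv hmem using 2 with k
      have : (fun _ : Fin k => ε • v) = fun i => (fun _ : Fin k => ε) i • (fun _ => v) i := rfl
      rw [this, ContinuousMultilinearMap.map_smul_univ]
      simp
      ring
  have hinj : Function.Injective fun k : ℕ => 2 * k := fun a b hab => by simpa using hab
  refine (hinj.hasSum_iff fun k hk => ?_).2 hall
  rw [taylorMean_of_odd, mul_zero]
  rw [← Nat.not_even_iff_odd]
  rintro ⟨j, rfl⟩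
  exact hk ⟨j, by simp [two_mul]⟩

end Cube

/-! ### Interpolation of quadratic objectives -/

/-- A family of functionals on a finite-dimensional space is a combination of finitely many of its
members, with coefficients that are evaluations at fixed vectors. -/
theorem exists_interpolation {K V : Type} {X : Type*} [Field K] [AddCommGroup V] [Module K V]
    [FiniteDimensional K V] (e : X → Module.Dual K V) :
    ∃ (ι : Type) (_ : Fintype ι) (H : ι → X) (v : ι → V),
      ∀ G w, e G w = ∑ i, e (H i) w * e G (v i) := by
  obtain ⟨b, hb, hspan, hli⟩ := exists_linearIndependent K (Set.range e)
  have : Finite b := hli.finite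
  have : Fintype b := Fintype.ofFinite b
  let B := Module.Basis.span hli
  -- The coordinates in a basis of the span extend to functionals on the whole dual. By reflexivity
  -- these are evaluations at vectors of `V`, so the coefficients of `e G` are themselves values of
  -- `e G`.
  choose ψ hψ using fun i => LinearMap.exists_extend (B.coord i)
  choose H hH using fun i : b => hb i.2
  refine ⟨b, this, H, fun i => (Module.evalEquiv K V).symm (ψ i), fun G w => ?_⟩
  have hmem : e G ∈ Submodule.span K (Set.range ((↑) : b → Module.Dual K V)) := by
    rw [Subtype.range_coe, hspan]
    exact Submodule.subset_span ⟨G, rfl⟩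
  have hsum := congrArg (fun f => (f.1 : Module.Dual K V) w) (B.sum_repr ⟨e G, hmem⟩)
  simp only [Submodule.coe_sum, Submodule.coe_smul, LinearMap.sum_apply, LinearMap.smul_apply,
    smul_eq_mul] at hsum
  rw [← hsum]
  refine Finset.sum_congr rfl fun i _ => ?_
  have h1 : e G ((Module.evalEquiv K V).symm (ψ i)) = B.repr ⟨e G, hmem⟩ i := by
    rw [Module.apply_evalEquiv_symm_apply]
    exact LinearMap.congr_fun (hψ i) ⟨e G, hmem⟩
  rw [h1, hH, mul_comm, Module.Basis.span_apply]

section Interpolation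

variable {n m N : ℕ}

theorem regTerm_add (β β' : Matrix (Fin N ⊕ Fin m) (Fin N) ℝ)
    (Γ Γ' : Matrix (Fin N ⊕ Fin m) (Fin N ⊕ Fin m) ℝ)
    (G : Matrix (Fin N) (Fin N) ℝ × Matrix (Fin N) (Fin m) ℝ) :
    regTerm (β + β') (Γ + Γ') G = regTerm β Γ G + regTerm β' Γ' G := by
  simp only [regTerm, Matrix.mul_add, Matrix.trace_add]
  ring

theorem regTerm_smul (c : ℝ) (β : Matrix (Fin N ⊕ Fin m) (Fin N) ℝ)
    (Γ : Matrix (Fin N ⊕ Fin m) (Fin N ⊕ Fin m) ℝ)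
    (G : Matrix (Fin N) (Fin N) ℝ × Matrix (Fin N) (Fin m) ℝ) :
    regTerm (c • β) (c • Γ) G = c * regTerm β Γ G := by
  simp only [regTerm, Matrix.mul_smul, Matrix.trace_smul, smul_eq_mul]
  ring

/-- The value `α + tr(𝒢 β) + tr(𝒢ᵀ 𝒢 Γ)`, as a linear functional of `(α, β, Γ)`. -/
def regEval (G : Matrix (Fin N) (Fin N) ℝ × Matrix (Fin N) (Fin m) ℝ) :
    Module.Dual ℝ (ℝ × Matrix (Fin N ⊕ Fin m) (Fin N) ℝ ×
      Matrix (Fin N ⊕ Fin m) (Fin N ⊕ Fin m) ℝ) where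
  toFun c := c.1 + regTerm c.2.1 c.2.2 G
  map_add' c c' := by simp only [Prod.fst_add, Prod.snd_add, regTerm_add]; ring
  map_smul' a c := by
    simp only [Prod.smul_fst, Prod.smul_snd, regTerm_smul, smul_eq_mul, RingHom.id_apply]; ring

theorem regEval_apply (G : Matrix (Fin N) (Fin N) ℝ × Matrix (Fin N) (Fin m) ℝ)
    (c : ℝ × Matrix (Fin N ⊕ Fin m) (Fin N) ℝ × Matrix (Fin N ⊕ Fin m) (Fin N ⊕ Fin m) ℝ) :
    regEval G c = c.1 + regTerm c.2.1 c.2.2 G := rfl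

theorem continuous_regEval
    (c : ℝ × Matrix (Fin N ⊕ Fin m) (Fin N) ℝ × Matrix (Fin N ⊕ Fin m) (Fin N ⊕ Fin m) ℝ) :
    Continuous fun G : Matrix (Fin N) (Fin N) ℝ × Matrix (Fin N) (Fin m) ℝ => regEval G c := by
  have h : Continuous fun G : Matrix (Fin N) (Fin N) ℝ × Matrix (Fin N) (Fin m) ℝ =>
      Matrix.fromCols G.1 G.2 := by
    refine continuous_matrix fun i j => ?_
    rcases j with j | j
    · exact continuous_fst.matrix_elem i j
    · exact continuous_snd.matrix_elem i j
  simp only [regEval_apply, regTerm]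
  fun_prop

/-- With `z = (φ(x), u)` the square expands to `‖φ(y)‖² - 2 φ(y)ᵀ𝒢z + zᵀ𝒢ᵀ𝒢z`, and the last two
terms are traces against rank-one matrices. -/
theorem residual_eq_regEval (φ : (Fin n → ℝ) → Fin N → ℝ)
    (p : (Fin n → ℝ) × (Fin n → ℝ) × (Fin m → ℝ))
    (G : Matrix (Fin N) (Fin N) ℝ × Matrix (Fin N) (Fin m) ℝ) :
    residual φ G p = regEval G (∑ i, φ p.1 i ^ 2,
      (-2 : ℝ) • Matrix.vecMulVec (Sum.elim (φ p.2.1) p.2.2) (φ p.1),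
      Matrix.vecMulVec (Sum.elim (φ p.2.1) p.2.2) (Sum.elim (φ p.2.1) p.2.2)) := by
  have hz : (Matrix.fromCols G.1 G.2).mulVec (Sum.elim (φ p.2.1) p.2.2) =
      G.1.mulVec (φ p.2.1) + G.2.mulVec p.2.2 := by
    rw [Matrix.fromCols_mulVec_sumElim]
  rw [regEval_apply, regTerm, Matrix.mul_smul, Matrix.trace_smul, Matrix.mul_vecMulVec,
    Matrix.mul_vecMulVec, Matrix.trace_vecMulVec, Matrix.trace_vecMulVec, ← Matrix.mulVec_mulVec,
    hz, Matrix.mulVec_transpose, ← Matrix.dotProduct_mulVec, hz]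
  simp only [residual, dotProduct, Finset.smul_sum, ← Finset.sum_add_distrib]
  refine Finset.sum_congr rfl fun i _ => ?_
  simp only [Pi.add_apply, smul_eq_mul]
  ring

theorem edmdCost_eq_sum_residual (φ : (Fin n → ℝ) → Fin N → ℝ) (z : ℕ → Fin n → ℝ)
    (v : ℕ → Fin m → ℝ) (T : ℕ) (G : Matrix (Fin N) (Fin N) ℝ × Matrix (Fin N) (Fin m) ℝ) :
    edmdCost φ z v T G = 1 / (T : ℝ) * ∑ t ∈ Finset.range T, residual φ G (dataPoint z v t) := by
  rw [edmdCost, frobSq, Finset.sum_comm, ← Fin.sum_univ_eq_sum_range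
    (fun t => residual φ G (dataPoint z v t)) T]
  rfl

/-- Residuals are combinations of finitely many of them, uniformly in the data point. -/
theorem exists_residual_interpolation (φ : (Fin n → ℝ) → Fin N → ℝ) :
    ∃ (ι : Type) (_ : Fintype ι) (H : ι → Matrix (Fin N) (Fin N) ℝ × Matrix (Fin N) (Fin m) ℝ)
      (c : ι → ℝ × Matrix (Fin N ⊕ Fin m) (Fin N) ℝ × Matrix (Fin N ⊕ Fin m) (Fin N ⊕ Fin m) ℝ),
      ∀ (G : Matrix (Fin N) (Fin N) ℝ × Matrix (Fin N) (Fin m) ℝ)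
        (p : (Fin n → ℝ) × (Fin n → ℝ) × (Fin m → ℝ)),
        residual φ G p = ∑ i, residual φ (H i) p * regEval G (c i) := by
  obtain ⟨ι, hι, H, c, h⟩ := exists_interpolation (K := ℝ)
    (regEval : Matrix (Fin N) (Fin N) ℝ × Matrix (Fin N) (Fin m) ℝ → _)
  refine ⟨ι, hι, H, c, fun G p => ?_⟩
  simp only [residual_eq_regEval]
  exact h G _

theorem residual_line (φ : (Fin n → ℝ) → Fin N → ℝ)
    (G D : Matrix (Fin N) (Fin N) ℝ × Matrix (Fin N) (Fin m) ℝ)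
    (p : (Fin n → ℝ) × (Fin n → ℝ) × (Fin m → ℝ)) (s : ℝ) :
    residual φ (G + s • D) p = residual φ G p +
      s * ∑ i, -2 * ((φ p.1 i - G.1.mulVec (φ p.2.1) i - G.2.mulVec p.2.2 i) *
        (D.1.mulVec (φ p.2.1) i + D.2.mulVec p.2.2 i)) +
      s ^ 2 * ∑ i, (D.1.mulVec (φ p.2.1) i + D.2.mulVec p.2.2 i) ^ 2 := by
  simp only [residual, Finset.mul_sum, ← Finset.sum_add_distrib]
  refine Finset.sum_congr rfl fun i _ => ?_
  simp only [Prod.fst_add, Prod.snd_add, Prod.smul_fst, Prod.smul_snd, Matrix.add_mulVec,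
    Matrix.smul_mulVec, Pi.add_apply, Pi.smul_apply, smul_eq_mul]
  ring

/-- The sign of `a` is convexity: `a` is the mean square of `D` applied to the data. The uniqueness
arguments use the costs along lines only through this form. -/
theorem exists_edmdCost_line (φ : (Fin n → ℝ) → Fin N → ℝ) (z : ℕ → Fin n → ℝ)
    (v : ℕ → Fin m → ℝ) (T : ℕ) (G D : Matrix (Fin N) (Fin N) ℝ × Matrix (Fin N) (Fin m) ℝ) :
    ∃ a b : ℝ, 0 ≤ a ∧ ∀ s : ℝ,
      edmdCost φ z v T (G + s • D) = edmdCost φ z v T G + s * b + s ^ 2 * a := by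
  refine ⟨1 / (T : ℝ) * ∑ t ∈ Finset.range T, ∑ i,
      (D.1.mulVec (φ (z t)) i + D.2.mulVec (v t) i) ^ 2,
    1 / (T : ℝ) * ∑ t ∈ Finset.range T, ∑ i, -2 *
      ((φ (z (t + 1)) i - G.1.mulVec (φ (z t)) i - G.2.mulVec (v t) i) *
        (D.1.mulVec (φ (z t)) i + D.2.mulVec (v t) i)), by positivity, fun s => ?_⟩
  simp only [edmdCost_eq_sum_residual, residual_line, Finset.sum_add_distrib, ← Finset.mul_sum,
    dataPoint]
  ring

end Interpolation

/-! ### Minimizers of converging quadratic objectives -/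

theorem argmin_add_const {X : Type*} (F : X → ℝ) (c : ℝ) :
    argmin (fun G => F G + c) = argmin F := by
  simp [argmin]

section Argmin

variable {E ι : Type*} [Fintype ι] {lam : ι → E → ℝ} {H : ι → E} {F : ℕ → E → ℝ} {J : E → ℝ}

/-- The limit keeps the same `lam`, so all functionals are controlled by their values at the
finitely many `H i`. -/
theorem interpolation_of_tendsto (hF : ∀ T G, F T G = ∑ i, F T (H i) * lam i G)
    (hJ : ∀ G, Tendsto (F · G) atTop (𝓝 (J G))) (G : E) : J G = ∑ i, J (H i) * lam i G := by
  refine tendsto_nhds_unique (hJ G) ?_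
  simp only [fun T => hF T G]
  exact tendsto_finsetSum _ fun i _ => (hJ (H i)).mul_const _

/-- Along an ultrafilter with `Gq T → G`, the finitely many coefficients `F T (H i)` and the values
`lam i (Gq T)` converge together, so `F T (Gq T) → J G`. No convexity is needed. -/
theorem mem_argmin_of_mapClusterPt [TopologicalSpace E] (hlam : ∀ i, Continuous (lam i))
    (hF : ∀ T G, F T G = ∑ i, F T (H i) * lam i G) (hJ : ∀ G, Tendsto (F · G) atTop (𝓝 (J G)))
    {Gq : ℕ → E} (hGq : ∀ᶠ T in atTop, Gq T ∈ argmin (F T)) {G : E}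
    (hG : MapClusterPt G atTop Gq) : G ∈ argmin J := by
  intro G'
  obtain ⟨U, hU, hUG⟩ := mapClusterPt_iff_ultrafilter.1 hG
  have h1 : Tendsto (fun T => F T (Gq T)) U (𝓝 (J G)) := by
    rw [interpolation_of_tendsto hF hJ G]
    simp only [fun T => hF T (Gq T)]
    exact tendsto_finsetSum _ fun i _ =>
      ((hJ (H i)).mono_left hU).mul (((hlam i).tendsto G).comp hUG)
  exact le_of_tendsto_of_tendsto h1 ((hJ G').mono_left hU)
    ((hGq.filter_mono hU).mono fun T hT => hT G')

variable [NormedAddCommGroup E] [NormedSpace ℝ E] [FiniteDimensional ℝ E]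

theorem eventually_forall_lt_of_argmin_eq (hlam : ∀ i, Continuous (lam i))
    (hF : ∀ T G, F T G = ∑ i, F T (H i) * lam i G) (hJ : ∀ G, Tendsto (F · G) atTop (𝓝 (J G)))
    (hline : ∀ T G D, ∃ a b : ℝ, 0 ≤ a ∧ ∀ s : ℝ, F T (G + s • D) = F T G + s * b + s ^ 2 * a)
    {G₀ : E} (hG₀ : argmin J = {G₀}) {δ : ℝ} (hδ : 0 < δ) :
    ∀ᶠ T in atTop, ∀ G, δ ≤ ‖G - G₀‖ → F T G₀ < F T G := by
  have hmin : ∀ G, J G₀ ≤ J G := by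
    have : G₀ ∈ argmin J := by rw [hG₀]; rfl
    exact this
  have hlt : ∀ G, G ≠ G₀ → J G₀ < J G := fun G hG => by
    refine lt_of_not_ge fun hle => hG ?_
    have : G ∈ argmin J := fun G' => hle.trans (hmin G')
    rwa [hG₀] at this
  have : ProperSpace E := FiniteDimensional.proper ℝ E
  -- Strict inequality on the sphere is an open condition on the coefficient vector `c` and the
  -- point; compactness makes it uniform over the sphere.
  have hsphere : ∀ᶠ c in 𝓝 (fun i => J (H i)), ∀ G ∈ Metric.sphere G₀ δ,
      ∑ i, c i * lam i G₀ < ∑ i, c i * lam i G := by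
    refine (isCompact_sphere G₀ δ).eventually_forall_of_forall_eventually
      (P := fun (c : ι → ℝ) G => ∑ i, c i * lam i G₀ < ∑ i, c i * lam i G) fun G hG => ?_
    refine (isOpen_lt (by fun_prop) (by fun_prop)).mem_nhds ?_
    simp only [Set.mem_ofPred_eq, ← interpolation_of_tendsto hF hJ]
    refine hlt G ?_
    rintro rfl
    simp [hδ.ne] at hG
  filter_upwards [(tendsto_pi_nhds.2 fun i => hJ (H i)).eventually hsphere] with T hT G hG
  simp only [← hF] at hT
  have hpos : 0 < ‖G - G₀‖ := hδ.trans_le hG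
  obtain ⟨a, b, ha, hab⟩ := hline T G₀ (G - G₀)
  have h1 := hab 1
  -- The segment from `G₀` to `G` meets the sphere at parameter `s = δ / ‖G - G₀‖ ≤ 1`. Positivity
  -- of `s (b + s a)` there forces `b + a ≥ b + s a > 0`.
  have hs := hT (G₀ + (δ / ‖G - G₀‖) • (G - G₀)) (by
    rw [mem_sphere_iff_norm, add_sub_cancel_left, norm_smul, norm_div, norm_norm,
      Real.norm_of_nonneg hδ.le, div_mul_cancel₀ _ hpos.ne'])
  rw [hab] at hs
  rw [one_smul, add_sub_cancel] at h1
  have hs0 : 0 < δ / ‖G - G₀‖ := by positivity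
  have hs1 : δ / ‖G - G₀‖ ≤ 1 := (div_le_one hpos).2 hG
  set s := δ / ‖G - G₀‖
  have h2 : 0 < s * (b + s * a) := by linarith [sq s]
  have h3 : 0 < b + s * a := pos_of_mul_pos_right h2 hs0.le
  nlinarith

theorem tendsto_of_argmin_eq (hlam : ∀ i, Continuous (lam i))
    (hF : ∀ T G, F T G = ∑ i, F T (H i) * lam i G) (hJ : ∀ G, Tendsto (F · G) atTop (𝓝 (J G)))
    (hline : ∀ T G D, ∃ a b : ℝ, 0 ≤ a ∧ ∀ s : ℝ, F T (G + s • D) = F T G + s * b + s ^ 2 * a)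
    {G₀ : E} (hG₀ : argmin J = {G₀}) {Gq : ℕ → E} (hGq : ∀ᶠ T in atTop, Gq T ∈ argmin (F T)) :
    Tendsto Gq atTop (𝓝 G₀) := by
  refine Metric.tendsto_nhds.2 fun δ hδ => ?_
  filter_upwards [eventually_forall_lt_of_argmin_eq hlam hF hJ hline hG₀ hδ, hGq] with T hT hq
  rw [dist_eq_norm]
  by_contra! h
  exact (hT _ h).not_ge (hq G₀)

theorem eventually_existsUnique_argmin (hlam : ∀ i, Continuous (lam i))
    (hF : ∀ T G, F T G = ∑ i, F T (H i) * lam i G) (hJ : ∀ G, Tendsto (F · G) atTop (𝓝 (J G)))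
    (hline : ∀ T G D, ∃ a b : ℝ, 0 ≤ a ∧ ∀ s : ℝ, F T (G + s • D) = F T G + s * b + s ^ 2 * a)
    {G₀ : E} (hG₀ : argmin J = {G₀}) : ∀ᶠ T in atTop, ∃! G, G ∈ argmin (F T) := by
  have : ProperSpace E := FiniteDimensional.proper ℝ E
  filter_upwards [eventually_forall_lt_of_argmin_eq hlam hF hJ hline hG₀ one_pos] with T hT
  have hcont : Continuous (F T) := by
    rw [show F T = fun G => ∑ i, F T (H i) * lam i G from funext (hF T)]
    fun_prop
  have hball : ∀ G ∈ argmin (F T), ‖G - G₀‖ < 1 := fun G hG => by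
    by_contra! h
    exact (hT G h).not_ge (hG G₀)
  obtain ⟨G, -, hG⟩ := (isCompact_closedBall G₀ 1).exists_isMinOn
    ⟨G₀, Metric.mem_closedBall_self zero_le_one⟩ hcont.continuousOn
  have hmem : G ∈ argmin (F T) := fun G' => by
    rcases le_total ‖G' - G₀‖ 1 with h | h
    · exact hG (mem_closedBall_iff_norm.2 h)
    · exact (hG (Metric.mem_closedBall_self zero_le_one)).trans (hT G' h).le
  refine ⟨G, hmem, fun G' hG' => ?_⟩
  by_contra hne
  have hpos : 0 < ‖G' - G‖ := norm_pos_iff.2 (sub_ne_zero.2 hne)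
  obtain ⟨a, b, ha, hab⟩ := hline T G (G' - G)
  have h1 := hab 1
  rw [one_smul, add_sub_cancel] at h1
  have heq : F T G' = F T G := le_antisymm (hG' G) (hmem G')
  -- Equal minimal values at parameters `0` and `1`, and no smaller value at `1/2`, force `a = b =
  -- 0`: the cost is constant on the whole line.
  have h2 := hmem (G + (1 / 2 : ℝ) • (G' - G))
  rw [hab] at h2
  have ha0 : a = 0 := by linarith
  have hb0 : b = 0 := by linarith
  -- A minimizer at distance `2` from `G` is impossible, since all minimizers lie in the open unit
  -- ball around `G₀`.
  have hfar : G + (2 / ‖G' - G‖) • (G' - G) ∈ argmin (F T) := fun K => by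
    rw [hab, ha0, hb0]
    simpa using hmem K
  have h3 := hball _ hfar
  have h4 := hball G hmem
  have h5 : ‖(2 / ‖G' - G‖) • (G' - G)‖ = 2 := by
    rw [norm_smul, norm_div, norm_norm, Real.norm_ofNat, div_mul_cancel₀ _ hpos.ne']
  have h6 := norm_sub_le (G + (2 / ‖G' - G‖) • (G' - G) - G₀) (G - G₀)
  rw [sub_sub_sub_cancel_right, add_sub_cancel_left, h5] at h6
  linarith

end Argmin

/-! ### The error of dither quantization -/

/-- The error of dither quantization in units of the resolution, without saturation. -/
def ditherError (lo ε s w : ℝ) : ℝ :=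
  1 / 2 - Int.fract ((s + w - lo) / ε)

theorem measurable_ditherError (lo ε s : ℝ) : Measurable (ditherError lo ε s) := by
  unfold ditherError
  fun_prop

theorem ditherError_mem_Icc (lo ε s w : ℝ) :
    ditherError lo ε s w ∈ Set.Icc (-(1 / 2) : ℝ) (1 / 2) := by
  have h0 := Int.fract_nonneg ((s + w - lo) / ε)
  have h1 := Int.fract_lt_one ((s + w - lo) / ε)
  constructor <;> unfold ditherError <;> linarith

theorem resolution_pos {lo hi : ℝ} (h : lo < hi) (b : ℕ) : 0 < resolution lo hi b :=
  div_pos (sub_pos.2 h) (by positivity)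

/-- Without overload, dither quantization adds `ditherError`, scaled by the resolution. -/
theorem ditherQuantize_eq {lo hi : ℝ} (h : lo < hi) (b : ℕ) {s w : ℝ}
    (hs : s ∈ Set.Icc (lo + resolution lo hi b / 2) (hi - resolution lo hi b / 2))
    (hw : w ∈ Set.Ico (-(resolution lo hi b / 2)) (resolution lo hi b / 2)) :
    ditherQuantize lo hi b s w =
      s + resolution lo hi b * ditherError lo (resolution lo hi b) s w := by
  have hε := resolution_pos h b
  obtain ⟨hs1, hs2⟩ := hs
  obtain ⟨hw1, hw2⟩ := hw
  -- Lower saturation occurs only at `s + w = lo`, where the floor is `0` as well. Upper saturation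
  -- is ruled out by the strict bound `w < ε / 2`.
  have henc : encode lo hi b (s + w) = ⌊(s + w - lo) / resolution lo hi b⌋ := by
    rw [encode]
    split_ifs with h1 h2
    · have : s + w - lo = 0 := by linarith
      simp [this]
    · linarith
    · rfl
  have hfl : (⌊(s + w - lo) / resolution lo hi b⌋ : ℝ) =
      (s + w - lo) / resolution lo hi b - Int.fract ((s + w - lo) / resolution lo hi b) := by
    rw [Int.self_sub_fract]
  rw [ditherQuantize, decode, henc, hfl, ditherError]
  field_simp
  ring

/-- For a dither that is uniform on `[-ε/2, ε/2]`, the scaled error is uniform on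
`[-1/2, 1/2]`. -/
theorem map_ditherError {Ω : Type*} [MeasurableSpace Ω] {P : Measure Ω} {ε : ℝ} (hε : 0 < ε)
    (lo s : ℝ) {w : Ω → ℝ} (hw : Measurable w)
    (hunif : pdf.IsUniform w (Set.Icc (-(ε / 2)) (ε / 2)) P) :
    P.map (fun ω => ditherError lo ε s (w ω)) =
      volume.restrict (Set.Icc (-(1 / 2) : ℝ) (1 / 2)) := by
  have hD := measurable_ditherError lo ε s
  have hvol : volume (Set.Icc (-(ε / 2)) (ε / 2)) = ENNReal.ofReal ε := by
    rw [Real.volume_Icc]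
    congr 1
    ring
  have hP : IsProbabilityMeasure P :=
    hunif.isProbabilityMeasure (by simp [hvol, hε]) (by simp [hvol])
  have : IsProbabilityMeasure (P.map (fun ω => ditherError lo ε s (w ω))) :=
    Measure.isProbabilityMeasure_map (hD.comp hw).aemeasurable
  ext B hB
  refine (measureReal_eq_measureReal_iff).1 ?_
  set f : ℝ → ℝ := B.indicator 1 with hf
  have hfm : Measurable f := measurable_one.indicator hB
  -- Periodicity in `w` allows the window of integration to be moved to `[lo - s, lo - s + ε]`.
  -- There, except at the right endpoint, the argument of `fract` lies in `[0, 1)`, and an affine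
  -- substitution remains.
  have hperiod : Function.Periodic (fun w => f (ditherError lo ε s w)) ε := fun w => by
    have : (s + (w + ε) - lo) / ε = (s + w - lo) / ε + 1 := by field_simp; ring
    simp only [ditherError, this, Int.fract_add_one]
  have hshift : ∫ w in -(ε / 2)..ε / 2, f (ditherError lo ε s w) =
      ∫ w in lo - s..lo - s + ε, f (ditherError lo ε s w) := by
    rw [← hperiod.intervalIntegral_add_eq (-(ε / 2)) (lo - s)]
    congr 1
    ring
  have hlin : ∫ w in lo - s..lo - s + ε, f (ditherError lo ε s w) =
      ∫ w in lo - s..lo - s + ε, f (1 / 2 + (lo - s) / ε - w / ε) := by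
    refine intervalIntegral.integral_congr_ae ?_
    filter_upwards [compl_mem_ae_iff.2 (measure_singleton (μ := volume) (lo - s + ε))] with w hne hw
    rw [Set.uIoc_of_le (by linarith)] at hw
    have hlt : w < lo - s + ε := lt_of_le_of_ne hw.2 hne
    rw [ditherError, Int.fract_eq_self.2]
    · congr 1
      field_simp
      ring
    · constructor
      · exact div_nonneg (by linarith [hw.1]) hε.le
      · rw [div_lt_one hε]; linarith
  have hsub : ∫ w in lo - s..lo - s + ε, f (1 / 2 + (lo - s) / ε - w / ε) =
      ε * ∫ x in -(1 / 2)..1 / 2, f x := by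
    rw [intervalIntegral.integral_comp_sub_div f hε.ne', smul_eq_mul]
    congr 2
    · field_simp
      ring
    · ring
  rw [← integral_indicator_one hB, ← integral_indicator_one hB, ← hf,
    integral_map (φ := fun ω => ditherError lo ε s (w ω)) (hD.comp hw).aemeasurable
      hfm.aestronglyMeasurable,
    ← integral_map (φ := w) (f := fun w => f (ditherError lo ε s w)) hw.aemeasurable
      (hfm.comp hD).aestronglyMeasurable, show P.map w = _ from hunif, ProbabilityTheory.cond,
    integral_smul_measure, hvol, integral_Icc_eq_integral_Ioc, integral_Icc_eq_integral_Ioc,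
    ← intervalIntegral.integral_of_le (by linarith),
    ← intervalIntegral.integral_of_le (by norm_num), hshift, hlin, hsub, ENNReal.toReal_inv,
    ENNReal.toReal_ofReal hε.le, smul_eq_mul, inv_mul_cancel_left₀ hε.ne']

/-! ### Joint law, independence and averages of the quantization errors. -/

section ErrorLaw

variable {n m : ℕ}

theorem map_triple_of_iIndepFun {Ω : Type*} [MeasurableSpace Ω] {P : Measure Ω}
    [IsProbabilityMeasure P] {V : Fin n ⊕ Fin n ⊕ Fin m → Ω → ℝ} (hV : ∀ c, Measurable (V c))
    (hindep : iIndepFun V P)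
    (hlaw : ∀ c, P.map (V c) = volume.restrict (Set.Icc (-(1 / 2) : ℝ) (1 / 2))) :
    P.map (fun ω => ((fun i => V (Sum.inl i) ω, fun i => V (Sum.inr (Sum.inl i)) ω,
      fun j => V (Sum.inr (Sum.inr j)) ω) : (Fin n → ℝ) × (Fin n → ℝ) × (Fin m → ℝ))) =
      volume.restrict (Metric.closedBall 0 (1 / 2)) := by
  have hpi := hindep.map_fun_eq_pi_map fun c => (hV c).aemeasurable
  simp only [hlaw] at hpi
  set μ : Measure ℝ := volume.restrict (Set.Icc (-(1 / 2) : ℝ) (1 / 2)) with hμ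
  have hcube : ∀ d : ℕ, (Measure.pi fun _ : Fin d => μ) =
      volume.restrict (Metric.closedBall (0 : Fin d → ℝ) (1 / 2)) := fun d => by
    rw [closedBall_pi _ (by norm_num), hμ, ← Measure.restrict_pi_pi, volume_pi]
    simp [Real.closedBall_eq_Icc]
  have h1 := measurePreserving_sumPiEquivProdPi (fun _ : Fin n ⊕ Fin n ⊕ Fin m => μ)
  have h2 := measurePreserving_sumPiEquivProdPi (fun _ : Fin n ⊕ Fin m => μ)
  have h3 := ((MeasurePreserving.id (Measure.pi fun _ : Fin n => μ)).prod h2).comp h1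
  have h0 : (0 : (Fin n → ℝ) × (Fin n → ℝ) × (Fin m → ℝ)) = (0, 0, 0) := rfl
  rw [h0, ← closedBall_prod_same, ← closedBall_prod_same, Measure.volume_eq_prod,
    ← Measure.prod_restrict, Measure.volume_eq_prod, ← Measure.prod_restrict, ← hcube, ← hcube,
    ← h3.map_eq, ← hpi, Measure.map_map h3.measurable (measurable_pi_lambda _ hV)]
  rfl

section Noise

variable {Ω : Type*}

/-- The error of dither quantization of the data point `(x_{t+1}, x_t, u_t)`, in units of the
resolution. -/
def noise (lo ε : ℝ) (x : ℕ → Fin n → ℝ) (u : ℕ → Fin m → ℝ) (w : ℕ → Fin n ⊕ Fin m → Ω → ℝ)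
    (t : ℕ) (ω : Ω) : (Fin n → ℝ) × (Fin n → ℝ) × (Fin m → ℝ) :=
  (fun i => ditherError lo ε (x (t + 1) i) (w (t + 1) (Sum.inl i) ω),
    fun i => ditherError lo ε (x t i) (w t (Sum.inl i) ω),
    fun j => ditherError lo ε (u t j) (w t (Sum.inr j) ω))

theorem noise_mem_closedBall (lo ε : ℝ) (x : ℕ → Fin n → ℝ) (u : ℕ → Fin m → ℝ)
    (w : ℕ → Fin n ⊕ Fin m → Ω → ℝ) (t : ℕ) (ω : Ω) :
    noise lo ε x u w t ω ∈ Metric.closedBall 0 (1 / 2) := by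
  have h : ∀ s y, ‖ditherError lo ε s y‖ ≤ 1 / 2 := fun s y =>
    abs_le.2 (ditherError_mem_Icc lo ε s y)
  rw [mem_closedBall_zero_iff, noise, Prod.norm_def, Prod.norm_def]
  refine max_le ?_ (max_le ?_ ?_) <;>
    exact (pi_norm_le_iff_of_nonneg (by norm_num)).2 fun i => h _ _

variable [MeasurableSpace Ω] {P : Measure Ω} {ε : ℝ} {w : ℕ → Fin n ⊕ Fin m → Ω → ℝ}

theorem measurable_noise (hw : IsDither P ε w) (lo : ℝ) (x : ℕ → Fin n → ℝ) (u : ℕ → Fin m → ℝ)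
    (t : ℕ) : Measurable (noise lo ε x u w t) :=
  (measurable_pi_lambda _ fun _ => (measurable_ditherError _ _ _).comp (hw.measurable _ _)).prodMk
    ((measurable_pi_lambda _ fun _ =>
      (measurable_ditherError _ _ _).comp (hw.measurable _ _)).prodMk
    (measurable_pi_lambda _ fun _ => (measurable_ditherError _ _ _).comp (hw.measurable _ _)))

theorem map_noise [IsProbabilityMeasure P] (hε : 0 < ε) (hw : IsDither P ε w) (lo : ℝ)
    (x : ℕ → Fin n → ℝ) (u : ℕ → Fin m → ℝ) (t : ℕ) :
    P.map (noise lo ε x u w t) = volume.restrict (Metric.closedBall 0 (1 / 2)) := by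
  -- The `2n + m` components use pairwise distinct dithers: the two state blocks differ in time, and
  -- states and inputs differ in index.
  let κ : Fin n ⊕ Fin n ⊕ Fin m → ℕ × (Fin n ⊕ Fin m) :=
    Sum.elim (fun i => (t + 1, Sum.inl i)) fun c => (t, c)
  let s : Fin n ⊕ Fin n ⊕ Fin m → ℝ := Sum.elim (x (t + 1)) (Sum.elim (x t) (u t))
  have hκ : Function.Injective κ := by
    refine Function.Injective.sumElim (fun i j h => ?_) (fun i j h => ?_) fun i j h => ?_
    · simpa using h
    · simpa using h
    · simp at h
  have hindep := (hw.indep.precomp hκ).comp (fun c => ditherError lo ε (s c))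
    fun c => measurable_ditherError lo ε (s c)
  refine map_triple_of_iIndepFun (V := fun c ω => ditherError lo ε (s c) (w (κ c).1 (κ c).2 ω))
    (fun c => (measurable_ditherError _ _ _).comp (hw.measurable _ _)) hindep fun c => ?_
  exact map_ditherError hε lo (s c) (hw.measurable _ _) (hw.uniform _ _)

/-- The error at time `t` depends only on the dithers at times `t` and `t + 1`, so a gap of two
makes the blocks `B s` and `B t` disjoint. -/
theorem indepFun_noise (hw : IsDither P ε w) (lo : ℝ) (x : ℕ → Fin n → ℝ) (u : ℕ → Fin m → ℝ)
    {s t : ℕ} (hst : s + 2 ≤ t) : IndepFun (noise lo ε x u w s) (noise lo ε x u w t) P := by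
  let B : ℕ → Finset (ℕ × (Fin n ⊕ Fin m)) := fun t => {t, t + 1} ×ˢ Finset.univ
  have h0 : ∀ t c, (t, c) ∈ B t := fun t c => by simp [B]
  have h1 : ∀ t c, (t + 1, c) ∈ B t := fun t c => by simp [B]
  let Ψ : ∀ t, (B t → ℝ) → (Fin n → ℝ) × (Fin n → ℝ) × (Fin m → ℝ) := fun t y =>
    (fun i => ditherError lo ε (x (t + 1) i) (y ⟨(t + 1, Sum.inl i), h1 t _⟩),
      fun i => ditherError lo ε (x t i) (y ⟨(t, Sum.inl i), h0 t _⟩),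
      fun j => ditherError lo ε (u t j) (y ⟨(t, Sum.inr j), h0 t _⟩))
  have hΨ : ∀ t, Measurable (Ψ t) := fun t =>
    (measurable_pi_lambda _ fun _ => (measurable_ditherError _ _ _).comp
      (measurable_pi_apply _)).prodMk ((measurable_pi_lambda _ fun _ =>
      (measurable_ditherError _ _ _).comp (measurable_pi_apply _)).prodMk
      (measurable_pi_lambda _ fun _ => (measurable_ditherError _ _ _).comp
      (measurable_pi_apply _)))
  have hdisj : Disjoint (B s) (B t) := by
    rw [Finset.disjoint_left]
    rintro ⟨r, c⟩ hs ht
    simp only [B, Finset.mem_product, Finset.mem_insert, Finset.mem_singleton, Finset.mem_univ,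
      and_true] at hs ht
    omega
  exact (hw.indep.indepFun_finset (B s) (B t) hdisj fun c => hw.measurable c.1 c.2).comp
    (hΨ s) (hΨ t)

/-- The right endpoint has to be discarded: a dither equal to `ε / 2` can push a value onto the
saturated upper end of the range. -/
theorem ae_mem_Ico_of_isDither (hε : 0 < ε) (hw : IsDither P ε w) :
    ∀ᵐ ω ∂P, ∀ t c, w t c ω ∈ Set.Ico (-(ε / 2)) (ε / 2) := by
  refine ae_all_iff.2 fun t => ae_all_iff.2 fun c => ?_
  have hvol : volume (Set.Icc (-(ε / 2)) (ε / 2)) = ENNReal.ofReal ε := by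
    rw [Real.volume_Icc]
    congr 1
    ring
  have h := (hw.uniform t c).measure_preimage (by simp [hvol, hε]) (by simp [hvol])
    (measurableSet_Ico (a := -(ε / 2)) (b := ε / 2)).compl
  have hzero : volume (Set.Icc (-(ε / 2)) (ε / 2) ∩ (Set.Ico (-(ε / 2)) (ε / 2))ᶜ) = 0 := by
    refine measure_mono_null (fun y hy => ?_) (measure_singleton (ε / 2))
    simp only [Set.mem_inter_iff, Set.mem_compl_iff, Set.mem_Ico, not_and, not_lt] at hy
    exact le_antisymm hy.1.2 (hy.2 hy.1.1)
  rw [hzero, ENNReal.zero_div] at h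
  have h0 := compl_mem_ae_iff.2 h
  rw [← Set.preimage_compl, compl_compl] at h0
  exact h0

theorem ae_dataPoint_quantized {lo hi : ℝ} (h : lo < hi) (b : ℕ) {x : ℕ → Fin n → ℝ}
    {u : ℕ → Fin m → ℝ} (hno : NoOverload lo hi b x u)
    (hw : IsDither P (resolution lo hi b) w) :
    ∀ᵐ ω ∂P, ∀ t, dataPoint (quantState lo hi b w x ω) (quantInput lo hi b w u ω) t =
      dataPoint x u t + resolution lo hi b • noise lo (resolution lo hi b) x u w t ω := by
  filter_upwards [ae_mem_Ico_of_isDither (resolution_pos h b) hw] with ω hω t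
  refine Prod.ext (funext fun i => ?_) (Prod.ext (funext fun i => ?_) (funext fun j => ?_))
  · exact ditherQuantize_eq h b (hno.1 _ _) (hω _ _)
  · exact ditherQuantize_eq h b (hno.1 _ _) (hω _ _)
  · exact ditherQuantize_eq h b (hno.2 _ _) (hω _ _)

/-- Time averages of a bounded function of the quantized data approach those of its means. -/
theorem ae_tendsto_average_sub_mean [IsProbabilityMeasure P] (hε : 0 < ε) (hw : IsDither P ε w)
    (lo : ℝ) (x : ℕ → Fin n → ℝ) (u : ℕ → Fin m → ℝ)
    {g : (Fin n → ℝ) × (Fin n → ℝ) × (Fin m → ℝ) → ℝ} (hg : Measurable g) {C : ℝ}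
    (hC : ∀ t, ∀ v ∈ Metric.closedBall 0 (1 / 2), |g (dataPoint x u t + ε • v)| ≤ C) :
    ∀ᵐ ω ∂P, Tendsto (fun T : ℕ => 1 / (T : ℝ) * ∑ t ∈ Finset.range T,
      (g (dataPoint x u t + ε • noise lo ε x u w t ω) -
        ∫ v in Metric.closedBall 0 (1 / 2), g (dataPoint x u t + ε • v))) atTop (𝓝 0) := by
  have hgm : ∀ t, Measurable fun v => g (dataPoint x u t + ε • v) := fun t =>
    hg.comp (by fun_prop)
  have hnoise := fun t => measurable_noise hw lo x u t
  have hbdd : ∀ t ω, |g (dataPoint x u t + ε • noise lo ε x u w t ω)| ≤ C := fun t ω =>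
    hC t _ (noise_mem_closedBall lo ε x u w t ω)
  have hint : ∀ t, |∫ v in Metric.closedBall 0 (1 / 2), g (dataPoint x u t + ε • v)| ≤ C :=
    fun t => by
      have := norm_integral_le_of_norm_le_const (f := fun v => g (dataPoint x u t + ε • v))
        (ae_restrict_of_forall_mem (μ := volume) measurableSet_closedBall (hC t))
      rwa [probReal_univ, mul_one] at this
  refine strong_law_of_bounded (C := C + C) (fun t => ((hgm t).comp (hnoise t)).sub_const _)
    (fun t ω => (abs_sub _ _).trans (add_le_add (hbdd t ω) (hint t))) (fun t => ?_)
    fun s t hst => (indepFun_noise hw lo x u hst).comp ((hgm s).sub_const _)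
      ((hgm t).sub_const _)
  have hi : Integrable (fun ω => g (dataPoint x u t + ε • noise lo ε x u w t ω)) P :=
    Integrable.of_bound ((hgm t).comp (hnoise t)).aestronglyMeasurable C (ae_of_all _ (hbdd t))
  rw [integral_sub hi (integrable_const _), integral_const, probReal_univ, one_smul,
    ← map_noise hε hw lo x u t, integral_map (hnoise t).aemeasurable
      (hgm t).aestronglyMeasurable, sub_self]

end Noise

end ErrorLaw

/-! ### Large-data limits of the Taylor terms -/

section Limits

variable {n m N : ℕ} {x : ℕ → Fin n → ℝ} {u : ℕ → Fin m → ℝ} {φ : (Fin n → ℝ) → Fin N → ℝ}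
  {ρ : ℝ≥0∞}

theorem abs_average_le {a : ℕ → ℝ} {C : ℝ} (hC : 0 ≤ C) (ha : ∀ t, |a t| ≤ C) (T : ℕ) :
    |1 / (T : ℝ) * ∑ t ∈ Finset.range T, a t| ≤ C := by
  rcases Nat.eq_zero_or_pos T with rfl | hT
  · simpa using hC
  have hTpos : (0 : ℝ) < T := by exact_mod_cast hT
  rw [abs_mul, abs_of_pos (one_div_pos.2 hTpos), one_div_mul_eq_div, div_le_iff₀ hTpos]
  refine (Finset.abs_sum_le_sum_abs _ _).trans ((Finset.sum_le_sum fun t _ => ha t).trans_eq ?_)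
  simp [mul_comm]

theorem totallyBounded_range_dataPoint {M : Set (Fin n → ℝ)} (hM : IsCompact M)
    (hx : ∀ t, x t ∈ M) {c : ℝ} (hu : ∀ t, ‖u t‖ ≤ c) :
    TotallyBounded (Set.range (dataPoint x u)) := by
  refine (hM.prod (hM.prod (isCompact_closedBall (0 : Fin m → ℝ) c))).totallyBounded.subset ?_
  rintro _ ⟨t, rfl⟩
  exact ⟨hx _, hx _, mem_closedBall_zero_iff.2 (hu t)⟩

theorem taylorMean_interpolation {ι : Type*} [Fintype ι]
    {g : (Fin n → ℝ) × (Fin n → ℝ) × (Fin m → ℝ) → ℝ}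
    {f : ι → (Fin n → ℝ) × (Fin n → ℝ) × (Fin m → ℝ) → ℝ} {c : ι → ℝ}
    (hg : ∀ q, g q = ∑ i, f i q * c i) {p : (Fin n → ℝ) × (Fin n → ℝ) × (Fin m → ℝ)}
    (hf : ∀ i, AnalyticAt ℝ (f i) p) (k : ℕ) :
    taylorMean k g p = ∑ i, taylorMean k (f i) p * c i := by
  have hg' : g = fun q => ∑ i, c i • f i q := by
    funext q
    simp only [hg, smul_eq_mul, mul_comm]
  have hder : iteratedFDeriv ℝ k g p = ∑ i, c i • iteratedFDeriv ℝ k (f i) p := by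
    rw [hg', iteratedFDeriv_fun_sum_apply fun i _ => (hf i).contDiffAt.const_smul (c i)]
    exact Finset.sum_congr rfl fun i _ => iteratedFDeriv_const_smul_apply' (hf i).contDiffAt
  simp only [taylorMean, ← integral_mul_const]
  rw [← integral_finsetSum _ fun i _ => (integrable_taylor k (f i) p).mul_const (c i)]
  refine integral_congr_ae (ae_of_all _ fun v => ?_)
  simp only [hder, sum_apply, smul_apply, smul_eq_mul, Finset.mul_sum]
  exact Finset.sum_congr rfl fun i _ => by ring

theorem taylorAverage_zero (G : Matrix (Fin N) (Fin N) ℝ × Matrix (Fin N) (Fin m) ℝ) (T : ℕ) :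
    taylorAverage φ x u 0 G T = edmdCost φ x u T G := by
  simp only [taylorAverage, taylorMean_zero, edmdCost_eq_sum_residual]

/-- The Taylor averages satisfy Cauchy estimates. -/
theorem exists_abs_taylorAverage_le (hK : TotallyBounded (Set.range (dataPoint x u)))
    {G : Matrix (Fin N) (Fin N) ℝ × Matrix (Fin N) (Fin m) ℝ}
    (hG : ∀ t, ∃ S : FormalMultilinearSeries ℝ _ ℝ,
      HasFPowerSeriesOnBall (residual φ G) S (dataPoint x u t) ρ) {ε : ℝ}
    (hε : 0 < ε) (hερ : ENNReal.ofReal (ε / 2) < ρ) :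
    ∃ r C : ℝ, 0 < r ∧ ε < 2 * r ∧ 0 ≤ C ∧
      (∀ t (k : ℕ) v, |1 / (k.factorial : ℝ) * iteratedFDeriv ℝ k (residual φ G)
        (dataPoint x u t) (fun _ => v)| * r ^ k ≤ C * ‖v‖ ^ k) ∧
      ∀ k T, |taylorAverage φ x u k G T| ≤ C * (1 / (2 * r)) ^ k := by
  obtain ⟨r, hr1, hr2⟩ := ENNReal.lt_iff_exists_nnreal_btwn.1 hερ
  have hεr : ε / 2 < r := (ENNReal.ofReal_lt_coe_iff (by positivity)).1 hr1
  have hr : (0 : ℝ) < r := by linarith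
  obtain ⟨C, hC, h⟩ := exists_forall_abs_taylor_le hK (g := residual φ G) (ρ := ρ)
    (by rintro _ ⟨t, rfl⟩; exact hG t) hr2
  have h' : ∀ t (k : ℕ) v, |1 / (k.factorial : ℝ) * iteratedFDeriv ℝ k (residual φ G)
      (dataPoint x u t) (fun _ => v)| * (r : ℝ) ^ k ≤ C * ‖v‖ ^ k := fun t => h _ ⟨t, rfl⟩
  refine ⟨r, C, hr, by linarith, hC, h', fun k T => ?_⟩
  refine abs_average_le (by positivity) (fun t => ?_) T
  rw [one_div, inv_pow, ← div_eq_mul_inv, le_div_iff₀ (by positivity)]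
  exact abs_taylorMean_mul_pow_le hC hr.le (h' t k)

variable {ℓ : ℕ → Matrix (Fin N) (Fin N) ℝ × Matrix (Fin N) (Fin m) ℝ → ℝ}

theorem exists_abs_limit_le (hK : TotallyBounded (Set.range (dataPoint x u)))
    {G : Matrix (Fin N) (Fin N) ℝ × Matrix (Fin N) (Fin m) ℝ}
    (hG : ∀ t, ∃ S : FormalMultilinearSeries ℝ _ ℝ,
      HasFPowerSeriesOnBall (residual φ G) S (dataPoint x u t) ρ)
    (hℓ : ∀ k, Tendsto (taylorAverage φ x u k G) atTop (𝓝 (ℓ k G))) {ε : ℝ}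
    (hε : 0 < ε) (hερ : ENNReal.ofReal (ε / 2) < ρ) :
    ∃ r C : ℝ, 0 < r ∧ ε < 2 * r ∧ 0 ≤ C ∧ ∀ k, |ℓ k G| ≤ C * (1 / (2 * r)) ^ k := by
  obtain ⟨r, C, hr, hεr, hC, -, h⟩ := exists_abs_taylorAverage_le hK hG hε hερ
  exact ⟨r, C, hr, hεr, hC, fun k => le_of_tendsto (hℓ k).abs (Eventually.of_forall (h k))⟩

theorem pow_two_mul_bound {ε r C a : ℝ} (hε : 0 ≤ ε) {k : ℕ}
    (h : |a| ≤ C * (1 / (2 * r)) ^ (2 * k)) :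
    ‖ε ^ (2 * k) * a‖ ≤ C * ((ε / (2 * r)) ^ 2) ^ k := by
  rw [norm_mul, Real.norm_of_nonneg (by positivity), Real.norm_eq_abs, ← pow_mul]
  calc ε ^ (2 * k) * |a| ≤ ε ^ (2 * k) * (C * (1 / (2 * r)) ^ (2 * k)) := by gcongr
    _ = C * (ε / (2 * r)) ^ (2 * k) := by rw [div_eq_mul_one_div ε, mul_pow]; ring

theorem summable_bound {ε r : ℝ} (hε : 0 < ε) (hεr : ε < 2 * r) (C : ℝ) :
    Summable fun k : ℕ => C * ((ε / (2 * r)) ^ 2) ^ k := by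
  have h : ε / (2 * r) < 1 := (div_lt_one (hε.trans hεr)).2 hεr
  have h0 : 0 ≤ ε / (2 * r) := (div_pos hε (hε.trans hεr)).le
  exact (summable_geometric_of_lt_one (by positivity) (pow_lt_one₀ h0 h two_ne_zero)).mul_left C

/-- The sum `∑_{k ≥ 1} ε^{2k} ℓ_{2k}(G)`. -/
def evenSum (ℓ : ℕ → Matrix (Fin N) (Fin N) ℝ × Matrix (Fin N) (Fin m) ℝ → ℝ) (ε : ℝ)
    (G : Matrix (Fin N) (Fin N) ℝ × Matrix (Fin N) (Fin m) ℝ) : ℝ :=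
  ∑' k : ℕ, ε ^ (2 * (k + 1)) * ℓ (2 * (k + 1)) G

theorem hasSum_evenSum (hK : TotallyBounded (Set.range (dataPoint x u)))
    {G : Matrix (Fin N) (Fin N) ℝ × Matrix (Fin N) (Fin m) ℝ}
    (hG : ∀ t, ∃ S : FormalMultilinearSeries ℝ _ ℝ,
      HasFPowerSeriesOnBall (residual φ G) S (dataPoint x u t) ρ)
    (hℓ : ∀ k, Tendsto (taylorAverage φ x u k G) atTop (𝓝 (ℓ k G))) {ε : ℝ}
    (hε : 0 < ε) (hερ : ENNReal.ofReal (ε / 2) < ρ) :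
    HasSum (fun k : ℕ => ε ^ (2 * (k + 1)) * ℓ (2 * (k + 1)) G) (evenSum ℓ ε G) := by
  obtain ⟨r, C, hr, hεr, hC, h⟩ := exists_abs_limit_le hK hG hℓ hε hερ
  have hs : Summable fun k : ℕ => ε ^ (2 * k) * ℓ (2 * k) G :=
    (summable_bound hε hεr C).of_norm_bounded fun k => pow_two_mul_bound hε.le (h (2 * k))
  exact ((summable_nat_add_iff 1).2 hs).hasSum

theorem evenSum_isBigO (hK : TotallyBounded (Set.range (dataPoint x u)))
    {G : Matrix (Fin N) (Fin N) ℝ × Matrix (Fin N) (Fin m) ℝ}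
    (hG : ∀ t, ∃ S : FormalMultilinearSeries ℝ _ ℝ,
      HasFPowerSeriesOnBall (residual φ G) S (dataPoint x u t) ρ)
    (hℓ : ∀ k, Tendsto (taylorAverage φ x u k G) atTop (𝓝 (ℓ k G))) :
    (fun ε => evenSum ℓ ε G) =O[𝓝[>] 0] (fun ε : ℝ => ε ^ 2) := by
  obtain ⟨S, hS⟩ := hG 0
  -- Positivity of `ρ` comes from the power series at time `0`. One admissible resolution `2 * δ`
  -- then fixes `r` and `C` for all small `ε`.
  obtain ⟨δ, hδ0, hδρ⟩ := ENNReal.lt_iff_exists_nnreal_btwn.1 hS.r_pos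
  have hδ : (0 : ℝ) < δ := by exact_mod_cast hδ0
  obtain ⟨r, C, hr, hδr, hC, h⟩ := exists_abs_limit_le hK hG hℓ (ε := 2 * δ) (by positivity)
    (by rwa [mul_div_cancel_left₀ _ two_ne_zero, ENNReal.ofReal_coe_nnreal])
  refine IsBigO.of_bound (C * (1 / (2 * r)) ^ 2 * 2) ?_
  filter_upwards [Ioo_mem_nhdsGT hr] with ε hε
  have hε0 : 0 < ε := hε.1
  have hq : (ε / (2 * r)) ^ 2 ≤ 1 / 2 := by
    have h1 : ε / (2 * r) ≤ 1 / 2 := by rw [div_le_iff₀ (by positivity)]; linarith [hε.2]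
    have h0 : 0 ≤ ε / (2 * r) := by positivity
    nlinarith
  -- For `ε < r` the ratio `(ε / (2r))²` is at most `1/2`, so the whole sum is at most twice the
  -- bound on its first term, which is of order `ε²`.
  have hgeom : HasSum (fun k : ℕ => C * (ε / (2 * r)) ^ 2 * (1 / 2) ^ k)
      (C * (ε / (2 * r)) ^ 2 * 2) := hasSum_geometric_two.mul_left _
  refine (tsum_of_norm_bounded hgeom fun k => ?_).trans_eq ?_
  · refine (pow_two_mul_bound hε0.le (h (2 * (k + 1)))).trans ?_
    rw [pow_succ', ← mul_assoc]
    gcongr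
  · rw [Real.norm_of_nonneg (by positivity)]
    field_simp

/-- The large-data limit of the mean residual at the quantized data. -/
theorem tendsto_average_mean_residual (hK : TotallyBounded (Set.range (dataPoint x u)))
    {G : Matrix (Fin N) (Fin N) ℝ × Matrix (Fin N) (Fin m) ℝ}
    (hG : ∀ t, ∃ S : FormalMultilinearSeries ℝ _ ℝ,
      HasFPowerSeriesOnBall (residual φ G) S (dataPoint x u t) ρ)
    (hℓ : ∀ k, Tendsto (taylorAverage φ x u k G) atTop (𝓝 (ℓ k G))) {ε : ℝ}
    (hε : 0 < ε) (hερ : ENNReal.ofReal (ε / 2) < ρ) :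
    Tendsto (fun T : ℕ => 1 / (T : ℝ) * ∑ t ∈ Finset.range T,
      ∫ v in Metric.closedBall 0 (1 / 2), residual φ G (dataPoint x u t + ε • v)) atTop
      (𝓝 (ℓ 0 G + evenSum ℓ ε G)) := by
  obtain ⟨r, C, hr, hεr, hC, hcoef, h⟩ := exists_abs_taylorAverage_le hK hG hε hερ
  have hmean : ∀ t, HasSum (fun k : ℕ => ε ^ (2 * k) *
      taylorMean (2 * k) (residual φ G) (dataPoint x u t))
      (∫ v in Metric.closedBall 0 (1 / 2), residual φ G (dataPoint x u t + ε • v)) := fun t =>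
    hasSum_taylorMean (hG t) hε hερ hεr hC (hcoef t)
  have hsum : ∀ T : ℕ, 1 / (T : ℝ) * ∑ t ∈ Finset.range T,
      ∫ v in Metric.closedBall 0 (1 / 2), residual φ G (dataPoint x u t + ε • v) =
      ∑' k, ε ^ (2 * k) * taylorAverage φ x u (2 * k) G T := fun T => by
    rw [← ((hasSum_sum fun t _ => hmean t).mul_left (1 / (T : ℝ))).tsum_eq]
    refine tsum_congr fun k => ?_
    rw [taylorAverage, ← Finset.mul_sum]
    ring
  have hlim : ℓ 0 G + evenSum ℓ ε G = ∑' k, ε ^ (2 * k) * ℓ (2 * k) G := by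
    have hs : Summable fun k : ℕ => ε ^ (2 * k) * ℓ (2 * k) G :=
      (summable_nat_add_iff 1).1 (hasSum_evenSum hK hG hℓ hε hερ).summable
    rw [hs.tsum_eq_zero_add, evenSum, mul_zero, pow_zero, one_mul]
  rw [hlim]
  simp only [hsum]
  -- The majorant does not depend on `T`, which justifies interchanging the limit and the sum.
  exact tendsto_tsum_of_dominated_convergence (summable_bound hε hεr C)
    (fun k => (hℓ (2 * k)).const_mul _)
    (Eventually.of_forall fun T k => pow_two_mul_bound hε.le (h (2 * k) T))

/-- The residual is a continuous function of `(φ(y), φ(x), u)`, and these stay in a compact box. The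
perturbed states may leave `M`, hence the use of global bounds on `φ`. -/
theorem exists_abs_residual_le {l h : Fin N → ℝ} (hφ : ∀ i z, l i ≤ φ z i ∧ φ z i ≤ h i) {c : ℝ}
    (hu : ∀ t, ‖u t‖ ≤ c) (x : ℕ → Fin n → ℝ)
    (G : Matrix (Fin N) (Fin N) ℝ × Matrix (Fin N) (Fin m) ℝ) {ε : ℝ} (hε : 0 < ε) :
    ∃ C, ∀ t, ∀ v ∈ Metric.closedBall 0 (1 / 2), |residual φ G (dataPoint x u t + ε • v)| ≤ C := by
  let Q : (Fin N → ℝ) × (Fin N → ℝ) × (Fin m → ℝ) → ℝ := fun q =>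
    ∑ i, (q.1 i - G.1.mulVec q.2.1 i - G.2.mulVec q.2.2 i) ^ 2
  have hQ : Continuous Q := by
    have h1 : Continuous fun q : (Fin N → ℝ) × (Fin N → ℝ) × (Fin m → ℝ) => G.1.mulVec q.2.1 := by
      fun_prop
    have h2 : Continuous fun q : (Fin N → ℝ) × (Fin N → ℝ) × (Fin m → ℝ) => G.2.mulVec q.2.2 := by
      fun_prop
    fun_prop
  have hcomp : IsCompact (Set.Icc l h ×ˢ (Set.Icc l h ×ˢ
      Metric.closedBall (0 : Fin m → ℝ) (c + ε * (1 / 2)))) :=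
    isCompact_Icc.prod (isCompact_Icc.prod (isCompact_closedBall _ _))
  obtain ⟨C, hC⟩ := hcomp.exists_bound_of_continuousOn hQ.continuousOn
  have hmem : ∀ z, φ z ∈ Set.Icc l h := fun z => ⟨fun i => (hφ i z).1, fun i => (hφ i z).2⟩
  refine ⟨C, fun t v hv => hC (φ _, φ _, _) ⟨hmem _, hmem _, ?_⟩⟩
  rw [mem_closedBall_zero_iff] at hv ⊢
  refine (norm_add_le _ _).trans (add_le_add (hu t) ?_)
  rw [Prod.smul_snd, Prod.smul_snd, norm_smul, Real.norm_of_nonneg hε.le]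
  gcongr
  exact (norm_snd_le _).trans ((norm_snd_le _).trans hv)

theorem continuous_residual (hφ : Continuous φ)
    (G : Matrix (Fin N) (Fin N) ℝ × Matrix (Fin N) (Fin m) ℝ) :
    Continuous (residual φ G : (Fin n → ℝ) × (Fin n → ℝ) × (Fin m → ℝ) → ℝ) := by
  have h1 : Continuous fun p : (Fin n → ℝ) × (Fin n → ℝ) × (Fin m → ℝ) =>
      G.1.mulVec (φ p.2.1) := by fun_prop
  have h2 : Continuous fun p : (Fin n → ℝ) × (Fin n → ℝ) × (Fin m → ℝ) => G.2.mulVec p.2.2 := by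
    fun_prop
  unfold residual
  fun_prop

/-- For every predictor, the quantized objective converges almost surely. -/
theorem ae_tendsto_edmdCost_quantized {Ω : Type*} [MeasurableSpace Ω] {P : Measure Ω}
    [IsProbabilityMeasure P] (hK : TotallyBounded (Set.range (dataPoint x u)))
    {G : Matrix (Fin N) (Fin N) ℝ × Matrix (Fin N) (Fin m) ℝ}
    (hG : ∀ t, ∃ S : FormalMultilinearSeries ℝ _ ℝ,
      HasFPowerSeriesOnBall (residual φ G) S (dataPoint x u t) ρ)
    (hℓ : ∀ k, Tendsto (taylorAverage φ x u k G) atTop (𝓝 (ℓ k G)))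
    {l h : Fin N → ℝ} (hφ : ∀ i z, l i ≤ φ z i ∧ φ z i ≤ h i) {c : ℝ} (hu : ∀ t, ‖u t‖ ≤ c)
    (hφc : Continuous φ) {lo hi : ℝ} (hlh : lo < hi) {b : ℕ}
    (hερ : ENNReal.ofReal (resolution lo hi b / 2) < ρ) (hno : NoOverload lo hi b x u)
    {w : ℕ → Fin n ⊕ Fin m → Ω → ℝ} (hw : IsDither P (resolution lo hi b) w) :
    ∀ᵐ ω ∂P, Tendsto (fun T => edmdCost φ (quantState lo hi b w x ω) (quantInput lo hi b w u ω)
      T G) atTop (𝓝 (ℓ 0 G + evenSum ℓ (resolution lo hi b) G)) := by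
  have hε := resolution_pos hlh b
  obtain ⟨C, hC⟩ := exists_abs_residual_le hφ hu x G hε
  filter_upwards [ae_dataPoint_quantized hlh b hno hw, ae_tendsto_average_sub_mean hε hw lo x u
    (continuous_residual hφc G).measurable hC] with ω h1 h2
  have h3 := h2.add (tendsto_average_mean_residual hK hG hℓ hε hερ)
  rw [zero_add] at h3
  refine h3.congr fun T => ?_
  rw [edmdCost_eq_sum_residual, ← mul_add, ← Finset.sum_add_distrib]
  simp only [h1, sub_add_cancel]

end Limits

end QuantEDMD

end

/-! ### Assembly of the theorem. -/

theorem theorem1 {n m N : ℕ}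
    -- the controlled system and its data
    (M : Set (Fin n → ℝ)) (hM : IsCompact M) (U : Set (Fin m → ℝ))
    (f : (Fin n → ℝ) → (Fin m → ℝ) → (Fin n → ℝ)) (hf : ∀ z ∈ M, ∀ v ∈ U, f z v ∈ M)
    (x : ℕ → Fin n → ℝ) (u : ℕ → Fin m → ℝ)
    (hx0 : x 0 ∈ M) (hu : ∀ t, u t ∈ U) (hx : ∀ t, x (t + 1) = f (x t) (u t))
    (φ : (Fin n → ℝ) → Fin N → ℝ)
    -- bounded observables and inputs
    (hφ : ∀ i, ∃ l h : ℝ, l < h ∧ ∀ z, l ≤ φ z i ∧ φ z i ≤ h)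
    (hub : ∃ umin umax : ℝ, ∀ t, ‖u t‖ ∈ Set.Icc umin umax)
    -- the residual has a convergent Taylor series of radius at least `ρ` at the data points
    (ρ : ℝ≥0∞)
    (hTaylor : ∀ G : Matrix (Fin N) (Fin N) ℝ × Matrix (Fin N) (Fin m) ℝ, ∀ t,
      ∃ S : FormalMultilinearSeries ℝ ((Fin n → ℝ) × (Fin n → ℝ) × (Fin m → ℝ)) ℝ,
        HasFPowerSeriesOnBall (QuantEDMD.residual φ G) S (QuantEDMD.dataPoint x u t) ρ)
    -- bounded gradients of the observables
    (hgrad : ∃ c : ℝ, 0 < c ∧ ∀ i, Differentiable ℝ (fun z => φ z i) ∧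
      ∀ z, ‖fderiv ℝ (fun y => φ y i) z‖ ≤ c)
    -- the large-data limits exist
    (hlim : ∀ (k : ℕ) (G : Matrix (Fin N) (Fin N) ℝ × Matrix (Fin N) (Fin m) ℝ),
      ∃ L : ℝ, Tendsto (QuantEDMD.taylorAverage φ x u k G) atTop (𝓝 L)) :
    ∃ (αc : ℕ → ℝ) (βc : ℕ → Matrix (Fin N ⊕ Fin m) (Fin N) ℝ)
      (Γc : ℕ → Matrix (Fin N ⊕ Fin m) (Fin N ⊕ Fin m) ℝ)
      (α : ℝ → ℝ) (β : ℝ → Matrix (Fin N ⊕ Fin m) (Fin N) ℝ)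
      (Γ : ℝ → Matrix (Fin N ⊕ Fin m) (Fin N ⊕ Fin m) ℝ),
      -- the coefficients are given by the Taylor terms of even order of the residual
      (∀ k : ℕ, 1 ≤ k → ∀ G : Matrix (Fin N) (Fin N) ℝ × Matrix (Fin N) (Fin m) ℝ,
        Tendsto (QuantEDMD.taylorAverage φ x u (2 * k) G) atTop
          (𝓝 (αc k + QuantEDMD.regTerm (βc k) (Γc k) G))) ∧
      (∀ ε : ℝ, 0 < ε → ENNReal.ofReal (ε / 2) < ρ →
        HasSum (fun k : ℕ => ε ^ (2 * (k + 1)) * αc (k + 1)) (α ε) ∧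
        HasSum (fun k : ℕ => ε ^ (2 * (k + 1)) • βc (k + 1)) (β ε) ∧
        HasSum (fun k : ℕ => ε ^ (2 * (k + 1)) • Γc (k + 1)) (Γ ε)) ∧
      -- the regularization matrices are `O(ε²)`
      (∀ i j, (fun ε : ℝ => β ε i j) =O[𝓝[>] 0] (fun ε : ℝ => ε ^ 2)) ∧
      (∀ i j, (fun ε : ℝ => Γ ε i j) =O[𝓝[>] 0] (fun ε : ℝ => ε ^ 2)) ∧
      -- large-data behaviour for every dither quantizer of resolution `ε` with `ε/2 < ρ`
      (∀ (lo hi : ℝ) (b : ℕ) (ε : ℝ), lo < hi → ε = QuantEDMD.resolution lo hi b →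
        ENNReal.ofReal (ε / 2) < ρ → QuantEDMD.NoOverload lo hi b x u →
        ∀ (Ω : Type*) [MeasurableSpace Ω] (P : Measure Ω) [IsProbabilityMeasure P]
          (w : ℕ → Fin n ⊕ Fin m → Ω → ℝ), QuantEDMD.IsDither P ε w →
          -- the quantized objectives converge, up to the constant `α ε`, to the regularized one
          (∀ᵐ ω ∂P, ∀ G : Matrix (Fin N) (Fin N) ℝ × Matrix (Fin N) (Fin m) ℝ,
            Tendsto (fun T : ℕ => QuantEDMD.edmdCost φ (QuantEDMD.quantState lo hi b w x ω)
                (QuantEDMD.quantInput lo hi b w u ω) T G) atTop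
              (𝓝 (QuantEDMD.regCost φ x u (β ε) (Γ ε) G + α ε))) ∧
          -- every accumulation point of quantized predictors solves the regularized problem
          (∀ᵐ ω ∂P, ∀ Gq : ℕ → Matrix (Fin N) (Fin N) ℝ × Matrix (Fin N) (Fin m) ℝ,
            (∀ᶠ T in atTop, Gq T ∈ QuantEDMD.argmin
              (QuantEDMD.edmdCost φ (QuantEDMD.quantState lo hi b w x ω)
                (QuantEDMD.quantInput lo hi b w u ω) T)) →
            ∀ G, MapClusterPt G atTop Gq →
              G ∈ QuantEDMD.argmin (QuantEDMD.regCost φ x u (β ε) (Γ ε))) ∧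
          -- if that problem has exactly one solution, the quantized predictor is eventually
          -- unique and converges to it
          (∀ G, QuantEDMD.argmin (QuantEDMD.regCost φ x u (β ε) (Γ ε)) = {G} →
            ∀ᵐ ω ∂P,
              (∀ᶠ T in atTop, ∃! G', G' ∈ QuantEDMD.argmin
                (QuantEDMD.edmdCost φ (QuantEDMD.quantState lo hi b w x ω)
                  (QuantEDMD.quantInput lo hi b w u ω) T)) ∧
              ∀ Gq : ℕ → Matrix (Fin N) (Fin N) ℝ × Matrix (Fin N) (Fin m) ℝ,
                (∀ᶠ T in atTop, Gq T ∈ QuantEDMD.argmin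
                  (QuantEDMD.edmdCost φ (QuantEDMD.quantState lo hi b w x ω)
                    (QuantEDMD.quantInput lo hi b w u ω) T)) →
                Tendsto Gq atTop (𝓝 G))) := by
  obtain ⟨umin, umax, hub⟩ := hub
  have hu' : ∀ t, ‖u t‖ ≤ umax := fun t => (hub t).2
  have hxM : ∀ t, x t ∈ M := fun t => by
    induction t with
    | zero => exact hx0
    | succ t ih => rw [hx]; exact hf _ ih _ (hu t)
  choose l h hlh using hφ
  have hbdd : ∀ i z, l i ≤ φ z i ∧ φ z i ≤ h i := fun i => (hlh i).2
  obtain ⟨_, _, hdiff⟩ := hgrad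
  have hφc : Continuous φ := continuous_pi fun i => (hdiff i).1.continuous
  have hK := QuantEDMD.totallyBounded_range_dataPoint hM hxM hu'
  choose ℓ hℓ using hlim
  obtain ⟨ι, _, H, c, hint⟩ := QuantEDMD.exists_residual_interpolation (m := m) φ
  have hcost : ∀ z v T G, QuantEDMD.edmdCost φ z v T G =
      ∑ i, QuantEDMD.edmdCost φ z v T (H i) * QuantEDMD.regEval G (c i) := fun z v T G => by
    simp only [QuantEDMD.edmdCost_eq_sum_residual, Finset.mul_sum, Finset.sum_mul]
    rw [Finset.sum_comm]
    refine Finset.sum_congr rfl fun t _ => ?_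
    rw [hint G, Finset.mul_sum]
    exact Finset.sum_congr rfl fun i _ => by ring
  have havg : ∀ k G T, QuantEDMD.taylorAverage φ x u k G T =
      ∑ i, QuantEDMD.taylorAverage φ x u k (H i) T * QuantEDMD.regEval G (c i) := fun k G T => by
    simp only [QuantEDMD.taylorAverage, Finset.mul_sum, Finset.sum_mul]
    rw [Finset.sum_comm]
    refine Finset.sum_congr rfl fun t _ => ?_
    rw [QuantEDMD.taylorMean_interpolation (hint G)
      (fun i => (hTaylor (H i) t).choose_spec.analyticAt) k, Finset.mul_sum]
    exact Finset.sum_congr rfl fun i _ => by ring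
  have hℓint : ∀ k G, ℓ k G = ∑ i, ℓ k (H i) * QuantEDMD.regEval G (c i) := fun k G => by
    refine tendsto_nhds_unique (hℓ k G) ?_
    rw [show QuantEDMD.taylorAverage φ x u k G = _ from funext (havg k G)]
    exact tendsto_finsetSum _ fun i _ => (hℓ k (H i)).mul_const _
  have heval : ∀ (a : ι → ℝ) G, QuantEDMD.regEval G (∑ i, a i • c i) =
      ∑ i, a i * QuantEDMD.regEval G (c i) := fun a G => by
    simp only [map_sum, map_smul, smul_eq_mul]
  -- Since `regEval G` is linear, weighting the interpolation vectors `c i` by `ℓ (2 * k) (H i)`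
  -- gives a triple `(α, β, Γ)` on which `regEval G` takes the value `ℓ (2 * k) G`. `D` does the
  -- same for the summed series.
  let C : ℕ → ℝ × Matrix (Fin N ⊕ Fin m) (Fin N) ℝ × Matrix (Fin N ⊕ Fin m) (Fin N ⊕ Fin m) ℝ :=
    fun k => ∑ i, ℓ (2 * k) (H i) • c i
  let D : ℝ → ℝ × Matrix (Fin N ⊕ Fin m) (Fin N) ℝ × Matrix (Fin N ⊕ Fin m) (Fin N ⊕ Fin m) ℝ :=
    fun ε => ∑ i, QuantEDMD.evenSum ℓ ε (H i) • c i
  have hsum : ∀ ε : ℝ, 0 < ε → ENNReal.ofReal (ε / 2) < ρ →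
      HasSum (fun k : ℕ => ε ^ (2 * (k + 1)) • C (k + 1)) (D ε) := fun ε hε hερ => by
    simp only [C, D, Finset.smul_sum, smul_smul]
    exact hasSum_sum fun i _ => (QuantEDMD.hasSum_evenSum hK (hTaylor (H i))
      (fun k => hℓ k (H i)) hε hερ).smul_const (c i)
  have hO : ∀ i, (fun ε => QuantEDMD.evenSum ℓ ε (H i)) =O[𝓝[>] 0] (fun ε : ℝ => ε ^ 2) :=
    fun i => QuantEDMD.evenSum_isBigO hK (hTaylor (H i)) fun k => hℓ k (H i)
  refine ⟨fun k => (C k).1, fun k => (C k).2.1, fun k => (C k).2.2, fun ε => (D ε).1,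
    fun ε => (D ε).2.1, fun ε => (D ε).2.2, fun k _ G => ?_, fun ε hε hερ => ⟨?_, ?_, ?_⟩,
    fun a b => ?_, fun a b => ?_, ?_⟩
  · rw [← QuantEDMD.regEval_apply, heval, ← hℓint]
    exact hℓ (2 * k) G
  · exact (hsum ε hε hερ).map (AddMonoidHom.fst _ _) continuous_fst
  · exact (hsum ε hε hερ).map ((AddMonoidHom.fst _ _).comp (AddMonoidHom.snd _ _))
      (continuous_fst.comp continuous_snd)
  · exact (hsum ε hε hερ).map ((AddMonoidHom.snd _ _).comp (AddMonoidHom.snd _ _))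
      (continuous_snd.comp continuous_snd)
  · simp only [D, Prod.snd_sum, Prod.fst_sum, Matrix.sum_apply, Prod.smul_snd, Prod.smul_fst,
      Matrix.smul_apply, smul_eq_mul]
    exact IsBigO.fun_sum fun i _ => by simpa [mul_comm] using (hO i).const_mul_left ((c i).2.1 a b)
  · simp only [D, Prod.snd_sum, Matrix.sum_apply, Prod.smul_snd, Matrix.smul_apply, smul_eq_mul]
    exact IsBigO.fun_sum fun i _ => by simpa [mul_comm] using (hO i).const_mul_left ((c i).2.2 a b)
  intro lo hi b ε hlohi hεdef hερ hno Ω _ P _ w hw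
  subst hεdef
  set ε := QuantEDMD.resolution lo hi b
  have hreg : ∀ G, QuantEDMD.regCost φ x u (D ε).2.1 (D ε).2.2 G + (D ε).1 =
      ∑ i, (ℓ 0 (H i) + QuantEDMD.evenSum ℓ ε (H i)) * QuantEDMD.regEval G (c i) := fun G => by
    have h0 : limsup (fun T => QuantEDMD.edmdCost φ x u T G) atTop = ℓ 0 G := by
      simp only [← QuantEDMD.taylorAverage_zero]
      exact (hℓ 0 G).limsup_eq
    simp only [add_mul, Finset.sum_add_distrib]
    rw [← hℓint, ← heval, QuantEDMD.regEval_apply, QuantEDMD.regCost, h0]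
    ring
  have hconv : ∀ᵐ ω ∂P, ∀ G, Tendsto (fun T : ℕ => QuantEDMD.edmdCost φ
      (QuantEDMD.quantState lo hi b w x ω) (QuantEDMD.quantInput lo hi b w u ω) T G) atTop
      (𝓝 (QuantEDMD.regCost φ x u (D ε).2.1 (D ε).2.2 G + (D ε).1)) := by
    -- Almost sure convergence is needed only at the finitely many `H i`; interpolation then gives
    -- every `G` outside the same null set.
    have hfin := ae_all_iff.2 fun i => QuantEDMD.ae_tendsto_edmdCost_quantized hK (hTaylor (H i))
      (fun k => hℓ k (H i)) hbdd hu' hφc hlohi hερ hno hw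
    filter_upwards [hfin] with ω hω G
    rw [hreg]
    simp only [fun T => hcost (QuantEDMD.quantState lo hi b w x ω)
      (QuantEDMD.quantInput lo hi b w u ω) T G]
    exact tendsto_finsetSum _ fun i _ => (hω i).mul_const _
  refine ⟨hconv, ?_, fun G hG => ?_⟩
  · filter_upwards [hconv] with ω hω Gq hGq G hG
    rw [← QuantEDMD.argmin_add_const _ (D ε).1]
    exact QuantEDMD.mem_argmin_of_mapClusterPt (fun i => QuantEDMD.continuous_regEval (c i))
      (hcost _ _) hω hGq hG
  -- The entrywise maximum norm induces the matrix topology in which convergence is stated.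
  · let _ : NormedAddCommGroup (Matrix (Fin N) (Fin N) ℝ) := Matrix.normedAddCommGroup
    let _ : NormedAddCommGroup (Matrix (Fin N) (Fin m) ℝ) := Matrix.normedAddCommGroup
    let _ : NormedSpace ℝ (Matrix (Fin N) (Fin N) ℝ) := Matrix.normedSpace
    let _ : NormedSpace ℝ (Matrix (Fin N) (Fin m) ℝ) := Matrix.normedSpace
    rw [← QuantEDMD.argmin_add_const _ (D ε).1] at hG
    filter_upwards [hconv] with ω hω
    exact ⟨QuantEDMD.eventually_existsUnique_argmin
        (fun i => QuantEDMD.continuous_regEval (c i)) (hcost _ _) hω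
        (QuantEDMD.exists_edmdCost_line φ _ _) hG,
      fun Gq hGq => QuantEDMD.tendsto_of_argmin_eq
        (fun i => QuantEDMD.continuous_regEval (c i)) (hcost _ _) hω
        (QuantEDMD.exists_edmdCost_line φ _ _) hG hGq⟩
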